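/- Identify $\mathbb{R}^4\times\mathbb{R}^4$ with $\mathbb{C}^4$ by $z=x+ip$, let $\omega=\sum_j dx_j\wedge dp_j$, and let $T^*S^3=\{(x,p):|x|=1,\ p\cdot x=0\}$. Let $F(x,p)=(|p|x,p)$ be the contraction of $T^*S^3$ onto the conifold $\mathcal{C}=\{z\in\mathbb{C}^4:\sum_j z_j^2=0\}$. Let $$\widehat{\mathcal{C}}=\{([u:v],z)\in\mathbb{CP}^1\times\mathbb{C}^4:\ w_1v-w_2u=w_3v-w_4u=0\},$$ where $w_1=z_1+iz_2$, $w_2=-z_3+iz_4$, $w_3=z_3+iz_4$, $w_4=z_1-iz_2$, be the resolved conifold, with projections $\pi_1,\pi_2$ to $\mathbb{CP}^1$ and $\mathbb{C}^4$, its complex structure $J$, the metric $\widehat g=\pi_1^*g_{FS}+\pi_2^*g_{st}$, and zero section $0(\widehat{\mathcal{C}})=\pi_2^{-1}(0)$. For $N\subset T^*S^3$ the conifold transition is $\mathrm{CT}(N)=\overline{\pi_2^{-1}(F(N)\setminus\{0\})}$. Let $k$ be a smooth knot in $S^3\subset\mathbb{R}^4$ parametrized by arc length, let $0<\varepsilon<1$,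 and let $$N^*_{k,\varepsilon}=\{(k(t),\,p+\varepsilon\dot k(t)):\ p\cdot k(t)=p\cdot\dot k(t)=0\}$$ be its perturbed conormal bundle. Then there is a smooth vector field $\xi$ on $\mathbb{R}^4$ with bounded derivative and with $\xi(r\,k(t))=\dot k(t)$ for all $t$ and all $r\ge\varepsilon$ (in particular $\xi(k(t))=\dot k(t)$) such that, with $\Phi_\varepsilon(x,p)=(x,p+\varepsilon\xi(x))$ and $\widetilde\omega_\varepsilon=(\pi_2^{-1})_*\Phi_{\varepsilon*}\omega$ (that is, the pullback by $\pi_2$ of $(\Phi_\varepsilon^{-1})^*\omega$), the following hold. (1) $\mathrm{CT}(N^*_{k,\varepsilon})$ is a uniformly tame Lagrangian in $\widehat{\mathcal{C}}$ by virtue of $\widetilde\omega_\varepsilon$: it is a smooth embedded submanifold of half the dimension of $\widehat{\mathcal{C}}$; on some open neighbourhood of it the form $\widetilde\omega_\varepsilon$ is symplectic and uniformly tame, i.e. there is a constant $C\ge1$ with $C^{-1}\widehat g(X,X)\le\widetilde\omega_\varepsilon(X,JX)\le C\,\widehat g(X,X)$ for all tangent vectors $X$ there; and $\widetilde\omega_\varepsilon$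 vanishes on the tangent spaces of $\mathrm{CT}(N^*_{k,\varepsilon})$. (2) $\widetilde\omega_\varepsilon$ is exact on $\widehat{\mathcal{C}}\setminus0(\widehat{\mathcal{C}})$. -/

import Mathlib

open Complex Set
open scoped Manifold ContDiff Topology

noncomputable section

namespace Conifold

/-! ## Differential forms, submanifolds and tame Lagrangians on a smooth manifold -/

section Manifold

variable {E : Type*} [NormedAddCommGroup E] [NormedSpace ℝ E]
variable {M : Type*} [TopologicalSpace M] [ChartedSpace E M]

variable (E M) in
/-- A (not necessarily continuous) field of alternating `n`-linear forms on the tangent spaces. -/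
abbrev Form (n : ℕ) : Type _ := ∀ q : M, TangentSpace 𝓘(ℝ, E) q [⋀^Fin n]→L[ℝ] ℝ

/-- The expression of a form in a chart: its pullback by the inverse of the chart. -/
def Form.inChart {n : ℕ} (α : Form E M n) (e : OpenPartialHomeomorph M E) :
    E → E [⋀^Fin n]→L[ℝ] ℝ := fun y =>
  (α (e.symm y)).compContinuousLinearMap (mfderiv 𝓘(ℝ, E) 𝓘(ℝ, E) e.symm y)

/-- `α` is a smooth differential form on the open set `U`. -/
def Form.SmoothOn {n : ℕ} (α : Form E M n) (U : Set M) : Prop :=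
  ∀ e ∈ atlas E M, ContDiffOn ℝ ∞ (α.inChart e) (e.target ∩ e.symm ⁻¹' U)

/-- The exterior derivative of a differential form, computed in the preferred chart at each
point. -/
def Form.d {n : ℕ} (α : Form E M n) : Form E M (n + 1) := fun q =>
  (extDeriv (α.inChart (chartAt E q)) (chartAt E q q)).compContinuousLinearMap
    (mfderiv 𝓘(ℝ, E) 𝓘(ℝ, E) (chartAt E q) q)

/-- `α` is exact on the open set `U`: it has a smooth primitive there. -/
def Form.ExactOn {n : ℕ} (α : Form E M (n + 1)) (U : Set M) : Prop :=
  ∃ μ : Form E M n, μ.SmoothOn U ∧ ∀ q ∈ U, α q = μ.d q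

/-- `α` is a symplectic form on the open set `U`: smooth, closed and nondegenerate. -/
def Form.SymplecticOn (α : Form E M 2) (U : Set M) : Prop :=
  α.SmoothOn U ∧ (∀ q ∈ U, α.d q = 0) ∧
    ∀ q ∈ U, ∀ X : TangentSpace 𝓘(ℝ, E) q, X ≠ 0 → ∃ Y, α q ![X, Y] ≠ 0

/-- `α` is uniformly tame on `U`, with respect to the almost complex structure `J` and the
Riemannian metric `g`. -/
def Form.UniformlyTameOn (α : Form E M 2)
    (J : ∀ q : M, TangentSpace 𝓘(ℝ, E) q →L[ℝ] TangentSpace 𝓘(ℝ, E) q)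
    (g : ∀ q : M, TangentSpace 𝓘(ℝ, E) q → TangentSpace 𝓘(ℝ, E) q → ℝ) (U : Set M) : Prop :=
  ∃ C : ℝ, 1 ≤ C ∧ ∀ q ∈ U, ∀ X : TangentSpace 𝓘(ℝ, E) q,
    C⁻¹ * g q X X ≤ α q ![X, J q X] ∧ α q ![X, J q X] ≤ C * g q X X

variable (E) in
/-- `L` is a smooth embedded submanifold of dimension `d`: near each of its points it is a
`d`-dimensional linear slice in some chart of the smooth structure. -/
def IsEmbeddedSubmanifold (d : ℕ) (L : Set M) : Prop :=
  ∀ q ∈ L, ∃ e ∈ IsManifold.maximalAtlas 𝓘(ℝ, E) ∞ M, q ∈ e.source ∧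
    ∃ V : Submodule ℝ E, Module.finrank ℝ V = d ∧ e.source ∩ L = e.source ∩ e ⁻¹' V

variable (E) in
/-- The tangent vectors to `L` at `q`: the velocities at time `0` of the smooth curves in `L`
through `q`. -/
def tangentVectors (L : Set M) (q : M) : Set (TangentSpace 𝓘(ℝ, E) q) :=
  {X | ∃ (γ : ℝ → M) (h : γ 0 = q), ContMDiffAt 𝓘(ℝ, ℝ) 𝓘(ℝ, E) ∞ γ 0 ∧ (∀ᶠ t in 𝓝 0, γ t ∈ L) ∧
    X = h ▸ mfderiv 𝓘(ℝ, ℝ) 𝓘(ℝ, E) γ 0 (1 : ℝ)}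

/-- `L` is a (uniformly) tame Lagrangian in `(M, J, g)` by virtue of the form `α`: it is an embedded
submanifold of half the dimension of `M`, the form `α` is symplectic and uniformly tame on a
neighbourhood of `L`, and `α` vanishes on the tangent spaces of `L`. -/
def IsTameLagrangian
    (J : ∀ q : M, TangentSpace 𝓘(ℝ, E) q →L[ℝ] TangentSpace 𝓘(ℝ, E) q)
    (g : ∀ q : M, TangentSpace 𝓘(ℝ, E) q → TangentSpace 𝓘(ℝ, E) q → ℝ)
    (α : Form E M 2) (L : Set M) : Prop :=
  (∃ d : ℕ, 2 * d = Module.finrank ℝ E ∧ IsEmbeddedSubmanifold E d L) ∧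
  (∃ U : Set M, IsOpen U ∧ L ⊆ U ∧ α.SymplecticOn U ∧ α.UniformlyTameOn J g U) ∧
  ∀ q ∈ L, ∀ X ∈ tangentVectors E L q, ∀ Y ∈ tangentVectors E L q, α q ![X, Y] = 0

end Manifold

/-! ## `ℝ⁴ × ℝ⁴ = ℂ⁴` -/

abbrev R4 : Type := EuclideanSpace ℝ (Fin 4)

abbrev C4 : Type := EuclideanSpace ℂ (Fin 4)

/-- The Euclidean inner product of a complex inner product space, as a real one. -/
def realInner {V : Type*} [NormedAddCommGroup V] [InnerProductSpace ℂ V] (a b : V) : ℝ :=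
  (inner ℂ a b).re

/-- The real part `x` of `z = x + i p`. -/
def rePart (z : C4) : R4 := WithLp.toLp 2 fun j => (z j).re

/-- The imaginary part `p` of `z = x + i p`. -/
def imPart (z : C4) : R4 := WithLp.toLp 2 fun j => (z j).im

/-- The identification `(x, p) ↦ x + i p`. -/
def ofXP (x p : R4) : C4 := WithLp.toLp 2 fun j => (x j : ℂ) + p j * I

/-- The real-linear coordinate `x_j` on `ℂ⁴`. -/
def dx (j : Fin 4) : C4 →L[ℝ] ℝ :=
  Complex.reCLM ∘L (EuclideanSpace.proj j : C4 →L[ℂ] ℂ).restrictScalars ℝ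

/-- The real-linear coordinate `p_j` on `ℂ⁴`. -/
def dp (j : Fin 4) : C4 →L[ℝ] ℝ :=
  Complex.imCLM ∘L (EuclideanSpace.proj j : C4 →L[ℂ] ℂ).restrictScalars ℝ

/-- The wedge product of two linear functionals. -/
def wedge {V : Type*} [NormedAddCommGroup V] [NormedSpace ℝ V] (a b : V →L[ℝ] ℝ) :
    V [⋀^Fin 2]→L[ℝ] ℝ :=
  ContinuousMultilinearMap.alternatization
    ((ContinuousMultilinearMap.mkPiAlgebra ℝ (Fin 2) ℝ).compContinuousLinearMap ![a, b])

theorem wedge_apply {V : Type*} [NormedAddCommGroup V] [NormedSpace ℝ V] (a b : V →L[ℝ] ℝ)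
    (X Y : V) : wedge a b ![X, Y] = a X * b Y - a Y * b X := by
  have h : (Finset.univ : Finset (Equiv.Perm (Fin 2))) = {1, Equiv.swap 0 1} := by decide
  have h' : (1 : Equiv.Perm (Fin 2)) ≠ Equiv.swap 0 1 := by decide
  simp [wedge, ContinuousMultilinearMap.alternatization_apply_apply, Fin.prod_univ_two, h,
    Finset.sum_pair h', sub_eq_add_neg]

/-- The standard Kähler form `∑ dx_j ∧ dp_j` on `ℂ⁴`. -/
def stdForm : C4 [⋀^Fin 2]→L[ℝ] ℝ := ∑ j, wedge (dx j) (dp j)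

/-- The pushforward `Φ_* β = (Φ⁻¹)^* β` of a 2-form on `ℂ⁴` by a diffeomorphism `Φ`. -/
def pushforward (Φ : C4 ≃ C4) (β : C4 → C4 [⋀^Fin 2]→L[ℝ] ℝ) : C4 → C4 [⋀^Fin 2]→L[ℝ] ℝ :=
  fun z => (β (Φ.symm z)).compContinuousLinearMap (fderiv ℝ Φ.symm z)

/-- The fibrewise translation `Φ_ε(x, p) = (x, p + ε ξ(x))` of `ℝ⁴ × ℝ⁴`. -/
def shear (ξ : R4 → R4) (ε : ℝ) : C4 ≃ C4 where
  toFun z := ofXP (rePart z) (imPart z + ε • ξ (rePart z))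
  invFun z := ofXP (rePart z) (imPart z - ε • ξ (rePart z))
  left_inv z := by ext j; apply Complex.ext <;> simp [ofXP, rePart, imPart]
  right_inv z := by ext j; apply Complex.ext <;> simp [ofXP, rePart, imPart]

/-! ## Knots and conormal bundles -/

/-- A smooth knot in the unit sphere `S³ ⊆ ℝ⁴`, with a parametrization by arc length. -/
structure Knot where
  toFun : ℝ → R4
  length : ℝ
  length_pos : 0 < length
  smooth : ContDiff ℝ ∞ toFun
  periodic : Function.Periodic toFun length
  injOn : InjOn toFun (Ico 0 length)
  norm_eq_one : ∀ t, ‖toFun t‖ = 1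
  unit_speed : ∀ t, ‖deriv toFun t‖ = 1

/-- The perturbed conormal bundle in `T^*S³ = {(x, p) | |x| = 1, p ⬝ x = 0}`. -/
def perturbedConormal (k : Knot) (ε : ℝ) : Set (R4 × R4) :=
  {y | ∃ (t : ℝ) (p : R4), inner ℝ p (k.toFun t) = 0 ∧ inner ℝ p (deriv k.toFun t) = 0 ∧
    y = (k.toFun t, p + ε • deriv k.toFun t)}

/-- The contraction `F(x, p) = (|p| x, p)` of `T^*S³` onto the conifold `{z | ∑ z_j² = 0}`. -/
def contraction (y : R4 × R4) : C4 := ofXP (‖y.2‖ • y.1) y.2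

/-! ## The complex projective line -/

/-- The complex projective line. -/
def CP1 : Type := Projectivization ℂ (Fin 2 → ℂ)

instance : TopologicalSpace CP1 :=
  inferInstanceAs (TopologicalSpace (Quotient (projectivizationSetoid ℂ (Fin 2 → ℂ))))

/-- Homogeneous coordinates. -/
def CP1.hom (p : CP1) : Fin 2 → ℂ := Projectivization.rep p

theorem CP1.hom_ne_zero (p : CP1) : p.hom ≠ 0 := Projectivization.rep_nonzero p

/-- The point `[v]` of the projective line. -/
def CP1.mk (v : Fin 2 → ℂ) (hv : v ≠ 0) : CP1 := Projectivization.mk ℂ v hv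

theorem CP1.exists_hom_mk (v : Fin 2 → ℂ) (hv : v ≠ 0) :
    ∃ a : ℂ, a ≠ 0 ∧ (CP1.mk v hv).hom = a • v := by
  obtain ⟨a, ha⟩ := Projectivization.exists_smul_eq_mk_rep ℂ v hv
  exact ⟨a, a.ne_zero, ha.symm⟩

theorem CP1.mk_eq_of_smul {v : Fin 2 → ℂ} (hv : v ≠ 0) (p : CP1) (a : ℂ) (h : a • p.hom = v) :
    CP1.mk v hv = p := by
  refine ((Projectivization.mk_eq_mk_iff' ℂ _ _ hv p.hom_ne_zero).2 ⟨a, h⟩).trans ?_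
  exact Projectivization.mk_rep _

theorem CP1.continuous_mk : Continuous fun v : {v : Fin 2 → ℂ // v ≠ 0} => CP1.mk v v.2 :=
  continuous_quotient_mk'

theorem CP1.isQuotientMap_mk :
    Topology.IsQuotientMap fun v : {v : Fin 2 → ℂ // v ≠ 0} => CP1.mk v v.2 :=
  isQuotientMap_quotient_mk'

/-- The vector with `i`-th entry `1` and the other entry `c`. -/
def affineVec (i : Fin 2) (c : ℂ) : Fin 2 → ℂ := fun j => if j = i then 1 else c

theorem affineVec_ne_zero (i : Fin 2) (c : ℂ) : affineVec i c ≠ 0 := fun h => by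
  simpa [affineVec] using congrFun h i

theorem hom_eq_smul_affineVec (i : Fin 2) (v : Fin 2 → ℂ) (h : v i ≠ 0) :
    (v i)⁻¹ • v = affineVec i (v (i + 1) / v i) := by
  ext j
  fin_cases i <;> fin_cases j <;> simp_all [affineVec] <;> field_simp

theorem CP1.isOpen_ne (i : Fin 2) : IsOpen {p : CP1 | p.hom i ≠ 0} := by
  rw [← CP1.isQuotientMap_mk.isOpen_preimage]
  have : (fun v : {v : Fin 2 → ℂ // v ≠ 0} => CP1.mk v v.2) ⁻¹' {p : CP1 | p.hom i ≠ 0} =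
      {v | v.1 i ≠ 0} := by
    ext v
    obtain ⟨a, ha, h⟩ := CP1.exists_hom_mk v.1 v.2
    simp [h, ha]
  erw [this]
  exact isOpen_ne_fun ((continuous_apply i).comp continuous_subtype_val) continuous_const

theorem CP1.continuousOn_affine (i : Fin 2) :
    ContinuousOn (fun p : CP1 => p.hom (i + 1) / p.hom i) {p : CP1 | p.hom i ≠ 0} := by
  rw [continuousOn_iff_continuous_domRestrict,
    (CP1.isQuotientMap_mk.restrictPreimage_isOpen (CP1.isOpen_ne i)).continuous_iff]
  have key : ∀ v : {v : Fin 2 → ℂ // v ≠ 0},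
      (CP1.mk v.1 v.2).hom (i + 1) / (CP1.mk v.1 v.2).hom i = v.1 (i + 1) / v.1 i := by
    intro v
    obtain ⟨a, ha, h⟩ := CP1.exists_hom_mk v.1 v.2
    simp only [h, Pi.smul_apply, smul_eq_mul]
    rw [mul_div_mul_left _ _ ha]
  have hne : ∀ x : (fun v : {v : Fin 2 → ℂ // v ≠ 0} => CP1.mk v v.2) ⁻¹'
      {p : CP1 | p.hom i ≠ 0}, x.1.1 i ≠ 0 := by
    rintro ⟨v, hv⟩
    obtain ⟨a, ha, h⟩ := CP1.exists_hom_mk v.1 v.2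
    simp only [mem_preimage, mem_ofPred_eq, h, Pi.smul_apply, smul_eq_mul] at hv
    exact right_ne_zero_of_mul hv
  have hc : ∀ j : Fin 2, Continuous fun x : (fun v : {v : Fin 2 → ℂ // v ≠ 0} => CP1.mk v v.2) ⁻¹'
      {p : CP1 | p.hom i ≠ 0} => x.1.1 j := fun j =>
    (continuous_apply j).comp (continuous_subtype_val.comp continuous_subtype_val)
  refine Continuous.congr (f := fun x => x.1.1 (i + 1) / x.1.1 i) ?_ fun x => (key x.1).symm
  exact Continuous.div (hc (i + 1)) (hc i) hne

/-- The affine chart of the projective line where the `i`-th homogeneous coordinate does not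
vanish; so `CP1.chart 1` is `[u : v] ↦ u / v`. -/
def CP1.chart (i : Fin 2) : OpenPartialHomeomorph CP1 ℂ where
  toFun p := p.hom (i + 1) / p.hom i
  invFun c := CP1.mk (affineVec i c) (affineVec_ne_zero i c)
  source := {p | p.hom i ≠ 0}
  target := univ
  map_source' _ _ := mem_univ _
  map_target' c _ := by
    obtain ⟨a, ha, h⟩ := CP1.exists_hom_mk _ (affineVec_ne_zero i c)
    simp [h, ha, affineVec]
  left_inv' p hp := CP1.mk_eq_of_smul _ p _ (hom_eq_smul_affineVec i p.hom hp)
  right_inv' c _ := by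
    obtain ⟨a, ha, h⟩ := CP1.exists_hom_mk _ (affineVec_ne_zero i c)
    simp [h, ha, affineVec]
  open_source := CP1.isOpen_ne i
  open_target := isOpen_univ
  continuousOn_toFun := CP1.continuousOn_affine i
  continuousOn_invFun := by
    refine Continuous.continuousOn ?_
    refine CP1.continuous_mk.comp (f := fun c => ⟨affineVec i c, affineVec_ne_zero i c⟩) ?_
    refine Continuous.subtype_mk (continuous_pi fun j => ?_) _
    by_cases h : j = i <;> simp [affineVec, h] <;> fun_prop

/-- The index of the preferred chart at a point. -/
def CP1.index (p : CP1) : Fin 2 := if p.hom 1 ≠ 0 then 1 else 0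

theorem CP1.hom_index_ne_zero (p : CP1) : p.hom p.index ≠ 0 := by
  unfold CP1.index
  split_ifs with h
  · exact h
  · intro h0
    apply p.hom_ne_zero
    ext j
    fin_cases j
    · exact h0
    · simpa using h

instance : ChartedSpace ℂ CP1 where
  atlas := range CP1.chart
  chartAt p := CP1.chart p.index
  mem_chart_source := CP1.hom_index_ne_zero
  chart_mem_atlas _ := mem_range_self _

/-- The Fubini-Study metric `|dc|² / (1 + |c|²)²`, in the affine coordinate `c` given by the
preferred chart at `p` (the expression is the same in both charts). -/
def fubiniStudy (p : CP1) (a b : TangentSpace 𝓘(ℝ, ℂ) p) : ℝ :=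
  realInner (V := ℂ) a b / (1 + ‖chartAt ℂ p p‖ ^ 2) ^ 2

/-! ## The resolved conifold -/

/-- The coordinates `w` on `ℂ⁴`, in which the conifold `∑ z_j² = 0` is the set of the singular
matrices with rows `(w 0, w 1)` and `(w 2, w 3)`. -/
def wCoord (z : C4) : Fin 4 → ℂ :=
  ![z 0 + I * z 1, -z 2 + I * z 3, z 2 + I * z 3, z 0 - I * z 1]

/-- The point of `ℂ⁴` with coordinates `w`. -/
def ofW (w : Fin 4 → ℂ) : C4 :=
  !₂[(w 0 + w 3) / 2, (w 0 - w 3) / (2 * I), (w 2 - w 1) / 2, (w 1 + w 2) / (2 * I)]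

theorem wCoord_ofW (w : Fin 4 → ℂ) : wCoord (ofW w) = w := by
  ext j
  fin_cases j <;> simp [wCoord, ofW] <;> field_simp <;> ring

theorem ofW_wCoord (z : C4) : ofW (wCoord z) = z := by
  ext j
  fin_cases j <;> simp [wCoord, ofW] <;> field_simp <;> ring

/-- The resolved conifold: the points `([u : v], z)` of `ℂP¹ × ℂ⁴` such that `w 0 * v - w 1 * u = 0`
and `w 2 * v - w 3 * u = 0`. -/
def ResolvedConifold : Type :=
  {q : CP1 × C4 // wCoord q.2 0 * q.1.hom 1 - wCoord q.2 1 * q.1.hom 0 = 0 ∧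
    wCoord q.2 2 * q.1.hom 1 - wCoord q.2 3 * q.1.hom 0 = 0}

namespace ResolvedConifold

instance : TopologicalSpace ResolvedConifold := instTopologicalSpaceSubtype

/-- The projection to the projective line. -/
def proj₁ (q : ResolvedConifold) : CP1 := q.1.1

/-- The projection to `ℂ⁴`. -/
def proj₂ (q : ResolvedConifold) : C4 := q.1.2

/-- The zero section. -/
def zeroSection : Set ResolvedConifold := {q | q.proj₂ = 0}

/-- The rank two bundle `𝒪(-1) ⊕ 𝒪(-1)` is trivialized by the frame `affineVec i c` of the
tautological line over the point with affine coordinate `c`. -/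
def bundleVec (i : Fin 2) (y : ℂ × ℂ × ℂ) : C4 :=
  ofW ![y.2.1 * affineVec i y.1 0, y.2.1 * affineVec i y.1 1,
    y.2.2 * affineVec i y.1 0, y.2.2 * affineVec i y.1 1]

/-- The inverse of a chart of the resolved conifold. -/
def ofChart (i : Fin 2) (y : ℂ × ℂ × ℂ) : ResolvedConifold :=
  ⟨((CP1.chart i).symm y.1, bundleVec i y), by
    obtain ⟨a, ha, h⟩ := CP1.exists_hom_mk _ (affineVec_ne_zero i y.1)
    change wCoord (bundleVec i y) 0 * (CP1.mk _ (affineVec_ne_zero i y.1)).hom 1 -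
      wCoord (bundleVec i y) 1 * (CP1.mk _ (affineVec_ne_zero i y.1)).hom 0 = 0 ∧
      wCoord (bundleVec i y) 2 * (CP1.mk _ (affineVec_ne_zero i y.1)).hom 1 -
      wCoord (bundleVec i y) 3 * (CP1.mk _ (affineVec_ne_zero i y.1)).hom 0 = 0
    rw [h, bundleVec, wCoord_ofW]
    constructor <;> simp <;> ring⟩

/-- The coordinates of a point of the resolved conifold: the affine coordinate on the projective
line, and two coordinates in the fibre. -/
def toChart (i : Fin 2) (q : ResolvedConifold) : ℂ × ℂ × ℂ :=
  (CP1.chart i q.proj₁, wCoord q.proj₂ (Fin.castAdd 2 i), wCoord q.proj₂ (Fin.natAdd 2 i))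

theorem toChart_ofChart (i : Fin 2) (y : ℂ × ℂ × ℂ) : toChart i (ofChart i y) = y := by
  refine Prod.ext ((CP1.chart i).right_inv (mem_univ y.1)) (Prod.ext ?_ ?_)
  · change wCoord (bundleVec i y) (Fin.castAdd 2 i) = y.2.1
    rw [bundleVec, wCoord_ofW]
    fin_cases i <;> simp [affineVec, Fin.castAdd]
  · change wCoord (bundleVec i y) (Fin.natAdd 2 i) = y.2.2
    rw [bundleVec, wCoord_ofW]
    fin_cases i <;> simp [affineVec, Fin.natAdd]

theorem ofChart_toChart (i : Fin 2) (q : ResolvedConifold) (hq : q.proj₁.hom i ≠ 0) :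
    ofChart i (toChart i q) = q := by
  obtain ⟨⟨p, z⟩, h1, h2⟩ := q
  refine Subtype.ext (Prod.ext ((CP1.chart i).left_inv hq) ?_)
  change bundleVec i (CP1.chart i p, wCoord z _, wCoord z _) = z
  rw [← ofW_wCoord z, bundleVec, wCoord_ofW]
  congr 1
  change p.hom i ≠ 0 at hq
  have hc : CP1.chart i p = p.hom (i + 1) / p.hom i := rfl
  simp only at h1 h2
  rw [hc]
  ext j
  fin_cases i <;> fin_cases j <;>
    simp [affineVec, Fin.castAdd, Fin.natAdd] at hq ⊢ <;> field_simp <;>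
    grind

theorem continuous_proj₁ : Continuous proj₁ := continuous_fst.comp continuous_subtype_val

theorem continuous_proj₂ : Continuous proj₂ := continuous_snd.comp continuous_subtype_val

theorem continuous_wCoord (j : Fin 4) : Continuous fun z => wCoord z j := by
  fin_cases j <;> simp [wCoord] <;> fun_prop

theorem contDiff_bundleVec (i : Fin 2) : ContDiff ℂ ⊤ (bundleVec i) := by
  rw [contDiff_euclidean]
  intro j
  fin_cases i <;> fin_cases j <;> simp [bundleVec, ofW, affineVec] <;> fun_prop

/-- The chart of the resolved conifold over an affine chart of the projective line. -/
def chart (i : Fin 2) : OpenPartialHomeomorph ResolvedConifold (ℂ × ℂ × ℂ) where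
  toFun := toChart i
  invFun := ofChart i
  source := {q | q.proj₁.hom i ≠ 0}
  target := univ
  map_source' _ _ := mem_univ _
  map_target' y _ := (CP1.chart i).map_target (mem_univ y.1)
  left_inv' q hq := ofChart_toChart i q hq
  right_inv' y _ := toChart_ofChart i y
  open_source := (CP1.isOpen_ne i).preimage continuous_proj₁
  open_target := isOpen_univ
  continuousOn_toFun := by
    refine ContinuousOn.prodMk ?_ (Continuous.continuousOn ?_)
    · exact (CP1.chart i).continuousOn.comp continuous_proj₁.continuousOn fun q hq => hq
    · exact ((continuous_wCoord _).comp continuous_proj₂).prodMk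
        ((continuous_wCoord _).comp continuous_proj₂)
  continuousOn_invFun := by
    refine Continuous.continuousOn (Continuous.subtype_mk (Continuous.prodMk ?_ ?_) _)
    · exact (continuousOn_univ.1 (CP1.chart i).continuousOn_symm).comp continuous_fst
    · exact (contDiff_bundleVec i).continuous

instance : ChartedSpace (ℂ × ℂ × ℂ) ResolvedConifold where
  atlas := range chart
  chartAt q := chart q.proj₁.index
  mem_chart_source q := q.proj₁.hom_index_ne_zero
  chart_mem_atlas _ := mem_range_self _

theorem contDiffOn_transition (i j : Fin 2) :
    ContDiffOn ℂ ⊤ (chart j ∘ (chart i).symm)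
      ((chart i).symm ≫ₕ chart j).source := by
  have hs : ∀ y ∈ ((chart i).symm ≫ₕ chart j).source, affineVec i y.1 j ≠ 0 := by
    rintro y ⟨-, hy⟩
    obtain ⟨a, ha, h⟩ := CP1.exists_hom_mk _ (affineVec_ne_zero i y.1)
    change (CP1.mk _ (affineVec_ne_zero i y.1)).hom j ≠ 0 at hy
    rw [h] at hy
    exact right_ne_zero_of_mul hy
  have hf : ∀ y : ℂ × ℂ × ℂ, (chart j ∘ (chart i).symm) y =
      (affineVec i y.1 (j + 1) / affineVec i y.1 j,
        y.2.1 * affineVec i y.1 j, y.2.2 * affineVec i y.1 j) := by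
    intro y
    obtain ⟨a, ha, h⟩ := CP1.exists_hom_mk _ (affineVec_ne_zero i y.1)
    refine Prod.ext ?_ (Prod.ext ?_ ?_)
    · change (CP1.mk _ (affineVec_ne_zero i y.1)).hom (j + 1) /
        (CP1.mk _ (affineVec_ne_zero i y.1)).hom j = _
      rw [h]
      exact mul_div_mul_left _ _ ha
    · change wCoord (bundleVec i y) (Fin.castAdd 2 j) = y.2.1 * affineVec i y.1 j
      rw [bundleVec, wCoord_ofW]
      fin_cases j <;> simp [Fin.castAdd]
    · change wCoord (bundleVec i y) (Fin.natAdd 2 j) = y.2.2 * affineVec i y.1 j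
      rw [bundleVec, wCoord_ofW]
      fin_cases j <;> simp [Fin.natAdd]
  have hc : ∀ l : Fin 2, ContDiff ℂ ⊤ fun y : ℂ × ℂ × ℂ => affineVec i y.1 l := by
    intro l
    by_cases h : l = i <;> simp [affineVec, h] <;> fun_prop
  refine ContDiffOn.congr ?_ fun y _ => hf y
  refine ContDiffOn.prodMk ((hc _).contDiffOn.div (hc _).contDiffOn hs) ?_
  exact ((contDiff_snd.fst.mul (hc _)).prodMk (contDiff_snd.snd.mul (hc _))).contDiffOn

/-- The resolved conifold is a complex manifold. -/
instance : IsManifold 𝓘(ℂ, ℂ × ℂ × ℂ) ω ResolvedConifold := by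
  refine isManifold_of_contDiffOn _ _ _ ?_
  rintro _ _ ⟨i, rfl⟩ ⟨j, rfl⟩
  simpa using contDiffOn_transition i j

/-- The resolved conifold is a smooth manifold. -/
instance : IsManifold 𝓘(ℝ, ℂ × ℂ × ℂ) ∞ ResolvedConifold := by
  refine isManifold_of_contDiffOn _ _ _ ?_
  rintro _ _ ⟨i, rfl⟩ ⟨j, rfl⟩
  simpa using ((contDiffOn_transition i j).restrict_scalars ℝ).of_le le_top

/-- The complex structure: multiplication by `i` in the (holomorphic) charts. -/
def J (q : ResolvedConifold) :
    TangentSpace 𝓘(ℝ, ℂ × ℂ × ℂ) q →L[ℝ] TangentSpace 𝓘(ℝ, ℂ × ℂ × ℂ) q :=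
  (I • ContinuousLinearMap.id ℝ (ℂ × ℂ × ℂ) : (ℂ × ℂ × ℂ) →L[ℝ] (ℂ × ℂ × ℂ))

/-- The Kähler metric `π₁^* g_FS + π₂^* g_st`. -/
def metric (q : ResolvedConifold) (X Y : TangentSpace 𝓘(ℝ, ℂ × ℂ × ℂ) q) : ℝ :=
  fubiniStudy q.proj₁ (mfderiv 𝓘(ℝ, ℂ × ℂ × ℂ) 𝓘(ℝ, ℂ) proj₁ q X)
    (mfderiv 𝓘(ℝ, ℂ × ℂ × ℂ) 𝓘(ℝ, ℂ) proj₁ q Y) +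
  realInner (V := C4) (mfderiv 𝓘(ℝ, ℂ × ℂ × ℂ) 𝓘(ℝ, C4) proj₂ q X)
    (mfderiv 𝓘(ℝ, ℂ × ℂ × ℂ) 𝓘(ℝ, C4) proj₂ q Y)

/-- The pullback of a 2-form on `ℂ⁴` by `π₂`. Away from the zero section `π₂` is a
biholomorphism onto the conifold without its singular point, and this is the pushforward by
`π₂⁻¹` of the restriction of the form to the conifold. -/
def lift (β : C4 → C4 [⋀^Fin 2]→L[ℝ] ℝ) : Form (ℂ × ℂ × ℂ) ResolvedConifold 2 := fun q =>
  (β q.proj₂).compContinuousLinearMap (mfderiv 𝓘(ℝ, ℂ × ℂ × ℂ) 𝓘(ℝ, C4) proj₂ q)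

end ResolvedConifold

/-- The conifold transition of a subset of `T^*S³`: the closure in the resolved conifold of
`π₂⁻¹(F(N) ∖ {0})`. -/
def conifoldTransition (N : Set (R4 × R4)) : Set ResolvedConifold :=
  closure (ResolvedConifold.proj₂ ⁻¹' (contraction '' N \ {0}))

/-- The form `(π₂⁻¹)_* (Φ_ε)_* (∑ dx_j ∧ dp_j)` on the resolved conifold. -/
def perturbedForm (ξ : R4 → R4) (ε : ℝ) : Form (ℂ × ℂ × ℂ) ResolvedConifold 2 :=
  ResolvedConifold.lift (pushforward (shear ξ ε) fun _ => stdForm)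

end Conifold

end

/-! Write $z=x+ip$ and let $D\xi$ be the derivative of $\xi$. Since $\pi_2$ is holomorphic, a
tangent vector $X$ with image $Z=d\pi_2(X)$ satisfies
$\widetilde\omega_\varepsilon(X,JX)=|Z|^2-\varepsilon\langle(D\xi-D\xi^{T})\,\mathrm{Re}\,Z,\mathrm{Im}\,Z\rangle$
(`pushforward_shear_I_smul`). Because $|\mathrm{Re}\,Z||\mathrm{Im}\,Z|\le|Z|^2/2$, this is
comparable to $|Z|^2$ as long as $\varepsilon\|D\xi-D\xi^{T}\|$ stays below a constant smaller than
2. Away from the zero section $|Z|^2$ is in turn comparable to $\widehat g(X,X)$, as the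
Fubini–Study part is at most $|Z|^2/|z|^2$ (`norm_sq_bundleVec_mul_le`). Taming implies
nondegeneracy.

So $\xi$ must have a small skew derivative at the points $x=|p|\,k(t)$ that occur, where
$|p|\ge\varepsilon$. It is taken homogeneous of degree 0 outside a ball, with derivative on $k$
given by $A=\ddot k\otimes\dot k+\dot k\otimes\ddot k+\dot k\otimes k$ (here $a\otimes b$ is
$v\mapsto\langle b,v\rangle a$). This $A$ sends $\dot k$ to $\ddot k$, as any extension of $\dot k$
requires, and kills $k$, as homogeneity requires, because $\langle k,\ddot k\rangle=-1$. Its skew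
difference $\dot k\otimes k-k\otimes\dot k$ has norm at most 1. Homogeneity turns this into the
bound $1/r$ at $r\,k(t)$, so $\varepsilon\|D\xi-D\xi^{T}\|\le\varepsilon/|p|\le1$
(`Knot.exists_vectorField`). Homogeneity also bounds $D\xi$ globally.

The bound $|p|\ge\varepsilon$ keeps $F(N)$ away from the singular point. As $F(N)$ is closed, the
transition is simply $\pi_2^{-1}(F(N))$, disjoint from the zero section. It is cut out locally by
three independent real equations in real dimension 6 (`Knot.surjective_equation`,
`exists_slice_chart`). Isotropy is a computation with velocities of curves
(`velocity_contraction_image`). Exactness comes from pulling back the primitive $\sum x_j\,dp_j$. -/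

namespace Conifold

noncomputable section

/-! ### Smoothness of pullbacks of alternating forms. -/

section AlternatingMap

variable {E F : Type*} [NormedAddCommGroup E] [NormedSpace ℝ E]
  [NormedAddCommGroup F] [NormedSpace ℝ F]

theorem continuous_alternatization (n : ℕ) : Continuous
    (ContinuousMultilinearMap.alternatization (R := ℝ) (M := E) (N := ℝ) (ι := Fin n)) := by
  rw [ContinuousAlternatingMap.isEmbedding_toContinuousMultilinearMap.continuous_iff]
  simp only [Function.comp_def,
    ContinuousMultilinearMap.alternatization_apply_toContinuousMultilinearMap]
  refine continuous_finsetSum _ fun σ _ => Continuous.const_smul ?_ _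
  exact (ContinuousMultilinearMap.domDomCongrₗᵢ ℝ E ℝ σ).continuous

theorem alternatization_toContinuousMultilinearMap {n : ℕ} (f : E [⋀^Fin n]→L[ℝ] ℝ) :
    f.toContinuousMultilinearMap.alternatization = (n.factorial : ℝ) • f := by
  ext v
  have h (σ : Equiv.Perm (Fin n)) : Equiv.Perm.sign σ • f (v ∘ σ) = f v := by
    rw [show f (v ∘ σ) = Equiv.Perm.sign σ • f v from f.toAlternatingMap.map_perm v σ, smul_smul,
      Int.units_mul_self, one_smul]
  simp [ContinuousMultilinearMap.alternatization_apply_apply, h, Fintype.card_perm]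

/-- Smoothness is inherited from composition of multilinear maps, which is polynomial in the linear
maps. Alternatization is continuous and multiplies an alternating map by $n!$, hence the division.
-/
theorem contDiff_compContinuousLinearMap {G : Type*} [NormedAddCommGroup G] [NormedSpace ℝ G]
    {n : ℕ} {r : WithTop ℕ∞} {β : G → F [⋀^Fin n]→L[ℝ] ℝ} {g : G → E →L[ℝ] F}
    (hβ : ContDiff ℝ r β) (hg : ContDiff ℝ r g) :
    ContDiff ℝ r fun x => (β x).compContinuousLinearMap (g x) := by
  let A : ContinuousMultilinearMap ℝ (fun _ : Fin n => E) ℝ →L[ℝ] E [⋀^Fin n]→L[ℝ] ℝ :=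
    ContinuousMultilinearMap.alternatization.toRealLinearMap (continuous_alternatization n)
  have h : (fun x => (β x).compContinuousLinearMap (g x)) = fun x => (n.factorial : ℝ)⁻¹ •
      A (ContinuousMultilinearMap.compContinuousLinearMapContinuousMultilinear ℝ
        (fun _ : Fin n => E) (fun _ => F) ℝ (fun _ => g x) (β x).toContinuousMultilinearMap) := by
    funext x
    rw [eq_inv_smul_iff₀ (by positivity), ← alternatization_toContinuousMultilinearMap]
    rfl
  rw [h]
  refine ContDiff.const_smul _ (A.contDiff.comp (ContDiff.clm_apply ?_ ?_))
  · exact (ContinuousMultilinearMap.contDiff _).comp (contDiff_pi.2 fun _ => hg)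
  · exact (ContinuousAlternatingMap.toContinuousMultilinearMapCLM ℝ).contDiff.comp hβ

theorem compContinuousLinearMap_pair (f : F [⋀^Fin 2]→L[ℝ] ℝ) (L : E →L[ℝ] F) (X Y : E) :
    f.compContinuousLinearMap L ![X, Y] = f ![L X, L Y] := by
  refine congrArg f ?_
  ext i : 1
  fin_cases i <;> rfl

end AlternatingMap

/-! ### The projections in charts, and pullback of forms by π₂. -/

namespace ResolvedConifold

theorem contDiff_bundleVec_real (i : Fin 2) : ContDiff ℝ ∞ (bundleVec i) :=
  ((contDiff_bundleVec i).restrict_scalars ℝ).of_le le_top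

theorem chart_mem_maximalAtlas (i : Fin 2) :
    chart i ∈ IsManifold.maximalAtlas 𝓘(ℝ, ℂ × ℂ × ℂ) ∞ ResolvedConifold :=
  IsManifold.subset_maximalAtlas (mem_range_self i)

theorem proj₂_eq_bundleVec {i : Fin 2} {q : ResolvedConifold} (hq : q ∈ (chart i).source) :
    q.proj₂ = bundleVec i (chart i q) := by
  conv_lhs => rw [← (chart i).left_inv hq]
  rfl

theorem proj₂_chart_symm (i : Fin 2) (y : ℂ × ℂ × ℂ) :
    proj₂ ((chart i).symm y) = bundleVec i y := rfl

theorem contMDiff_proj₂ : ContMDiff 𝓘(ℝ, ℂ × ℂ × ℂ) 𝓘(ℝ, C4) ∞ proj₂ := by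
  intro q
  set i := q.proj₁.index
  have hq : q ∈ (chart i).source := q.proj₁.hom_index_ne_zero
  have h1 : ContMDiffAt 𝓘(ℝ, ℂ × ℂ × ℂ) 𝓘(ℝ, ℂ × ℂ × ℂ) ∞ (chart i) q :=
    contMDiffAt_of_mem_maximalAtlas (chart_mem_maximalAtlas i) hq
  have h2 : ContMDiffAt 𝓘(ℝ, ℂ × ℂ × ℂ) 𝓘(ℝ, C4) ∞ (bundleVec i ∘ chart i) q :=
    (contDiff_bundleVec_real i).contMDiff.contMDiffAt.comp q h1
  refine h2.congr_of_eventuallyEq ?_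
  filter_upwards [(chart i).open_source.mem_nhds hq] with q' hq'
  exact proj₂_eq_bundleVec hq'

theorem mfderiv_proj₂_comp_chart_symm (i : Fin 2) (y : ℂ × ℂ × ℂ) :
    (mfderiv 𝓘(ℝ, ℂ × ℂ × ℂ) 𝓘(ℝ, C4) proj₂ ((chart i).symm y)).comp
      (mfderiv 𝓘(ℝ, ℂ × ℂ × ℂ) 𝓘(ℝ, ℂ × ℂ × ℂ) (chart i).symm y) =
    fderiv ℝ (bundleVec i) y := by
  rw [← mfderiv_eq_fderiv]
  have h1 : MDifferentiableAt 𝓘(ℝ, ℂ × ℂ × ℂ) 𝓘(ℝ, ℂ × ℂ × ℂ) (chart i).symm y :=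
    (contMDiffAt_symm_of_mem_maximalAtlas (chart_mem_maximalAtlas i)
      (mem_univ y)).mdifferentiableAt (by simp)
  have h2 := (contMDiff_proj₂ ((chart i).symm y)).mdifferentiableAt (by simp)
  exact (mfderiv_comp y h2 h1).symm

theorem mfderiv_proj₂_eq_comp_chart {i : Fin 2} {q : ResolvedConifold}
    (hq : q ∈ (chart i).source) :
    mfderiv 𝓘(ℝ, ℂ × ℂ × ℂ) 𝓘(ℝ, C4) proj₂ q =
    (fderiv ℝ (bundleVec i) (chart i q)).comp
      (mfderiv 𝓘(ℝ, ℂ × ℂ × ℂ) 𝓘(ℝ, ℂ × ℂ × ℂ) (chart i) q) := by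
  have h1 : MDifferentiableAt 𝓘(ℝ, ℂ × ℂ × ℂ) 𝓘(ℝ, ℂ × ℂ × ℂ) (chart i) q :=
    (contMDiffAt_of_mem_maximalAtlas (chart_mem_maximalAtlas i) hq).mdifferentiableAt (by simp)
  have h2 : MDifferentiableAt 𝓘(ℝ, ℂ × ℂ × ℂ) 𝓘(ℝ, C4) (bundleVec i) (chart i q) :=
    ((contDiff_bundleVec_real i).contMDiff.contMDiffAt).mdifferentiableAt (by simp)
  rw [← mfderiv_eq_fderiv]
  refine Eq.trans ?_ (mfderiv_comp q h2 h1)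
  apply Filter.EventuallyEq.mfderiv_eq
  filter_upwards [(chart i).open_source.mem_nhds hq] with q' hq'
  exact proj₂_eq_bundleVec hq'

theorem mfderiv_proj₂ (q : ResolvedConifold) :
    mfderiv 𝓘(ℝ, ℂ × ℂ × ℂ) 𝓘(ℝ, C4) proj₂ q =
      fderiv ℝ (bundleVec q.proj₁.index) (chart q.proj₁.index q) := by
  refine (if_pos ((contMDiff_proj₂ q).mdifferentiableAt (by simp))).trans ?_
  simp only [mfld_simps, fderivWithin_univ]
  rfl

/-- The preferred charts at `q` and at its image in the projective line have the same index, so in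
them the projection is literally the first coordinate. -/
theorem mfderiv_proj₁ (q : ResolvedConifold) :
    mfderiv 𝓘(ℝ, ℂ × ℂ × ℂ) 𝓘(ℝ, ℂ) proj₁ q =
      ContinuousLinearMap.fst ℝ ℂ (ℂ × ℂ) := by
  have key : writtenInExtChartAt 𝓘(ℝ, ℂ × ℂ × ℂ) 𝓘(ℝ, ℂ) q proj₁ = Prod.fst := by
    funext y
    change CP1.chart q.proj₁.index ((CP1.chart q.proj₁.index).symm y.1) = y.1
    exact (CP1.chart _).right_inv (mem_univ _)
  have hd : MDifferentiableAt 𝓘(ℝ, ℂ × ℂ × ℂ) 𝓘(ℝ, ℂ) proj₁ q := by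
    refine ⟨continuous_proj₁.continuousAt.continuousWithinAt, ?_⟩
    change DifferentiableWithinAt ℝ (writtenInExtChartAt 𝓘(ℝ, ℂ × ℂ × ℂ) 𝓘(ℝ, ℂ) q proj₁) _ _
    rw [key]
    exact differentiableWithinAt_fst
  refine (if_pos hd).trans ?_
  rw [key]
  simp only [mfld_simps, fderivWithin_univ]
  exact fderiv_fst

/-- The pullback by `π₂` of a form on `ℂ⁴`. -/
def pullback {n : ℕ} (β : C4 → C4 [⋀^Fin n]→L[ℝ] ℝ) : Form (ℂ × ℂ × ℂ) ResolvedConifold n :=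
  fun q => (β q.proj₂).compContinuousLinearMap (mfderiv 𝓘(ℝ, ℂ × ℂ × ℂ) 𝓘(ℝ, C4) proj₂ q)

theorem inChart_pullback {n : ℕ} (β : C4 → C4 [⋀^Fin n]→L[ℝ] ℝ) (i : Fin 2) :
    (pullback β).inChart (chart i) = fun y =>
      (β (bundleVec i y)).compContinuousLinearMap (fderiv ℝ (bundleVec i) y) := by
  funext y
  rw [← mfderiv_proj₂_comp_chart_symm]
  rfl

theorem smoothOn_pullback {n : ℕ} {β : C4 → C4 [⋀^Fin n]→L[ℝ] ℝ} (hβ : ContDiff ℝ ∞ β)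
    (U : Set ResolvedConifold) : (pullback β).SmoothOn U := by
  rintro _ ⟨i, rfl⟩
  rw [inChart_pullback]
  exact (contDiff_compContinuousLinearMap (hβ.comp (contDiff_bundleVec_real i))
    ((contDiff_bundleVec_real i).fderiv_right (by simp))).contDiffOn

/-- Naturality of the exterior derivative under `bundleVec`, followed by the chain rule through the
preferred chart. -/
theorem d_pullback {n : ℕ} {β : C4 → C4 [⋀^Fin n]→L[ℝ] ℝ} (hβ : ContDiff ℝ ∞ β)
    (q : ResolvedConifold) : (pullback β).d q = pullback (extDeriv β) q := by
  have hq : q ∈ (chart q.proj₁.index).source := q.proj₁.hom_index_ne_zero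
  change (extDeriv ((pullback β).inChart (chart q.proj₁.index))
    (chart q.proj₁.index q)).compContinuousLinearMap
    (mfderiv 𝓘(ℝ, ℂ × ℂ × ℂ) 𝓘(ℝ, ℂ × ℂ × ℂ) (chart q.proj₁.index) q) = _
  rw [inChart_pullback, extDeriv_pullback (r := ∞) (hβ.differentiable (by simp) _)
    (contDiff_bundleVec_real _).contDiffAt
    (by rw [minSmoothness_of_isRCLikeNormedField]; exact WithTop.coe_le_coe.2 le_top)]
  rw [pullback, mfderiv_proj₂_eq_comp_chart hq, proj₂_eq_bundleVec hq]
  rfl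

end ResolvedConifold

/-! ### The shear, its pushforward of the standard form, and a primitive. -/

/-- The real part, as a continuous linear map. -/
def reL : C4 →L[ℝ] R4 :=
  LinearMap.toContinuousLinearMap
    { toFun := rePart
      map_add' := fun a b => by ext j; simp [rePart]
      map_smul' := fun a b => by ext j; simp [rePart] }

/-- The imaginary part, as a continuous linear map. -/
def imL : C4 →L[ℝ] R4 :=
  LinearMap.toContinuousLinearMap
    { toFun := imPart
      map_add' := fun a b => by ext j; simp [imPart]
      map_smul' := fun a b => by ext j; simp [imPart] }

/-- The map `(x, p) ↦ x + i p`, as a continuous linear map. -/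
def ofXPL : R4 × R4 →L[ℝ] C4 :=
  LinearMap.toContinuousLinearMap
    { toFun := fun y => ofXP y.1 y.2
      map_add' := fun a b => by ext j; simp [ofXP]; ring
      map_smul' := fun a b => by ext j; simp [ofXP]; ring }

@[simp] theorem reL_apply (z : C4) : reL z = rePart z := rfl

@[simp] theorem imL_apply (z : C4) : imL z = imPart z := rfl

@[simp] theorem ofXPL_apply (y : R4 × R4) : ofXPL y = ofXP y.1 y.2 := rfl

@[simp] theorem rePart_ofXP (x p : R4) : rePart (ofXP x p) = x := by
  ext j; simp [ofXP, rePart]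

@[simp] theorem imPart_ofXP (x p : R4) : imPart (ofXP x p) = p := by
  ext j; simp [ofXP, imPart]

@[simp] theorem ofXP_rePart_imPart (z : C4) : ofXP (rePart z) (imPart z) = z := by
  ext j; apply Complex.ext <;> simp [ofXP, rePart, imPart]

theorem norm_sq_eq_rePart_imPart (z : C4) : ‖z‖ ^ 2 = ‖rePart z‖ ^ 2 + ‖imPart z‖ ^ 2 := by
  simp only [EuclideanSpace.norm_sq_eq, rePart, imPart, ← Finset.sum_add_distrib]
  refine Finset.sum_congr rfl fun j _ => ?_
  rw [← Complex.normSq_eq_norm_sq, Complex.normSq_apply, Real.norm_eq_abs, Real.norm_eq_abs, sq_abs,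
    sq_abs]
  ring

theorem stdForm_apply (X Y : C4) :
    stdForm ![X, Y] = inner ℝ (rePart X) (imPart Y) - inner ℝ (rePart Y) (imPart X) := by
  simp only [stdForm, ContinuousAlternatingMap.sum_apply, wedge_apply, PiLp.inner_apply,
    ← Finset.sum_sub_distrib]
  refine Finset.sum_congr rfl fun j _ => ?_
  simp [dx, dp, rePart, imPart]
  ring

/-- The Liouville form `∑ x_j dp_j`. -/
def liouville : C4 →L[ℝ] C4 [⋀^Fin 1]→L[ℝ] ℝ :=
  ((ContinuousAlternatingMap.ofSubsingletonLIE (𝕜 := ℝ) (E := C4) (F := ℝ)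
    (0 : Fin 1)).toContinuousLinearEquiv.toContinuousLinearMap) ∘L
    ((ContinuousLinearMap.compL ℝ C4 R4 ℝ).flip imL) ∘L (innerSL ℝ) ∘L reL

theorem liouville_apply (z : C4) (v : Fin 1 → C4) :
    liouville z v = inner ℝ (rePart z) (imPart (v 0)) := by
  rfl

theorem extDeriv_liouville (z : C4) : extDeriv (fun z => liouville z) z = stdForm := by
  ext v
  have hv : v = ![v 0, v 1] := by ext i; fin_cases i <;> rfl
  rw [extDeriv_apply liouville.differentiableAt, hv, stdForm_apply, Fin.sum_univ_two]
  have h (w : Fin 1 → C4) (X : C4) : fderiv ℝ (fun z => liouville z w) z X = liouville X w := by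
    have h' : HasFDerivAt (fun z => liouville z w)
      ((ContinuousAlternatingMap.apply ℝ C4 ℝ w) ∘L liouville) z :=
      ((ContinuousAlternatingMap.apply ℝ C4 ℝ w) ∘L liouville).hasFDerivAt
    rw [h'.fderiv]
    rfl
  simp only [h]
  simp [liouville_apply, Fin.removeNth]
  ring

theorem hasFDerivAt_shear_symm {ξ : R4 → R4} (hξ : Differentiable ℝ ξ) (ε : ℝ) (z : C4) :
    HasFDerivAt (shear ξ ε).symm
      (ofXPL ∘L (reL.prod (imL - ε • (fderiv ℝ ξ (rePart z) ∘L reL)))) z := by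
  have h1 : HasFDerivAt (fun z => ξ (reL z)) (fderiv ℝ ξ (rePart z) ∘L reL) z :=
    (hξ (rePart z)).hasFDerivAt.comp z reL.hasFDerivAt
  exact ofXPL.hasFDerivAt.comp z (reL.hasFDerivAt.prodMk (imL.hasFDerivAt.sub (h1.const_smul ε)))

theorem contDiff_shear_symm {ξ : R4 → R4} (hξ : ContDiff ℝ ∞ ξ) (ε : ℝ) :
    ContDiff ℝ ∞ (shear ξ ε).symm := by
  have h1 : ContDiff ℝ ∞ fun z => (reL z, imL z - ε • ξ (reL z)) :=
    reL.contDiff.prodMk (imL.contDiff.sub ((hξ.comp reL.contDiff).const_smul ε))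
  exact ofXPL.contDiff.comp h1

theorem pushforward_shear_apply {ξ : R4 → R4} (hξ : Differentiable ℝ ξ) (ε : ℝ) (z X Y : C4) :
    pushforward (shear ξ ε) (fun _ => stdForm) z ![X, Y] =
      inner ℝ (rePart X) (imPart Y - ε • fderiv ℝ ξ (rePart z) (rePart Y)) -
      inner ℝ (rePart Y) (imPart X - ε • fderiv ℝ ξ (rePart z) (rePart X)) := by
  rw [pushforward, (hasFDerivAt_shear_symm hξ ε z).fderiv]
  rw [compContinuousLinearMap_pair, stdForm_apply]
  simp

/-- A primitive of the pushforward of the standard form by the shear. -/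
def shearPrimitive (ξ : R4 → R4) (ε : ℝ) (z : C4) : C4 [⋀^Fin 1]→L[ℝ] ℝ :=
  (liouville ((shear ξ ε).symm z)).compContinuousLinearMap (fderiv ℝ (shear ξ ε).symm z)

theorem contDiff_shearPrimitive {ξ : R4 → R4} (hξ : ContDiff ℝ ∞ ξ) (ε : ℝ) :
    ContDiff ℝ ∞ (shearPrimitive ξ ε) :=
  contDiff_compContinuousLinearMap (liouville.contDiff.comp (contDiff_shear_symm hξ ε))
    ((contDiff_shear_symm hξ ε).fderiv_right (by simp))

theorem contDiff_pushforward_shear {ξ : R4 → R4} (hξ : ContDiff ℝ ∞ ξ) (ε : ℝ) :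
    ContDiff ℝ ∞ (pushforward (shear ξ ε) fun _ => stdForm) :=
  contDiff_compContinuousLinearMap contDiff_const
    ((contDiff_shear_symm hξ ε).fderiv_right (by simp))

theorem extDeriv_shearPrimitive {ξ : R4 → R4} (hξ : ContDiff ℝ ∞ ξ) (ε : ℝ) :
    extDeriv (shearPrimitive ξ ε) = pushforward (shear ξ ε) fun _ => stdForm := by
  funext z
  refine (extDeriv_pullback (r := ∞) liouville.differentiableAt
    (contDiff_shear_symm hξ ε).contDiffAt
    (by rw [minSmoothness_of_isRCLikeNormedField]; exact WithTop.coe_le_coe.2 le_top)).trans ?_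
  rw [extDeriv_liouville]
  rfl

theorem perturbedForm_smoothOn {ξ : R4 → R4} (hξ : ContDiff ℝ ∞ ξ) (ε : ℝ)
    (U : Set ResolvedConifold) : (perturbedForm ξ ε).SmoothOn U :=
  ResolvedConifold.smoothOn_pullback (contDiff_pushforward_shear hξ ε) U

/-- The primitive is pulled back from a smooth form on all of ℂ⁴, so no restriction on `U` is
needed. -/
theorem perturbedForm_exactOn {ξ : R4 → R4} (hξ : ContDiff ℝ ∞ ξ) (ε : ℝ)
    (U : Set ResolvedConifold) : (perturbedForm ξ ε).ExactOn U := by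
  refine ⟨ResolvedConifold.pullback (shearPrimitive ξ ε),
    ResolvedConifold.smoothOn_pullback (contDiff_shearPrimitive hξ ε) U, fun q _ => ?_⟩
  rw [ResolvedConifold.d_pullback (contDiff_shearPrimitive hξ ε), extDeriv_shearPrimitive hξ]
  rfl

theorem perturbedForm_d {ξ : R4 → R4} (hξ : ContDiff ℝ ∞ ξ) (ε : ℝ) (q : ResolvedConifold) :
    (perturbedForm ξ ε).d q = 0 := by
  refine (ResolvedConifold.d_pullback (contDiff_pushforward_shear hξ ε) q).trans ?_
  rw [← extDeriv_shearPrimitive hξ, extDeriv_extDeriv (contDiff_shearPrimitive hξ ε)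
    (by rw [minSmoothness_of_isRCLikeNormedField]; exact WithTop.coe_le_coe.2 le_top)]
  rfl

/-! ### Comparison of the metric with the pullback of the Euclidean metric. -/

/-- The coordinate `w_j`, as a real-linear map. -/
def wCoordL (j : Fin 4) : C4 →L[ℝ] ℂ :=
  LinearMap.toContinuousLinearMap
    { toFun := fun z => wCoord z j
      map_add' := fun a b => by fin_cases j <;> simp [wCoord] <;> ring
      map_smul' := fun a b => by fin_cases j <;> simp [wCoord] <;> ring }

theorem wCoordL_apply (j : Fin 4) (z : C4) : wCoordL j z = wCoord z j := rfl

theorem sum_norm_sq_wCoord (z : C4) : ∑ j, ‖wCoord z j‖ ^ 2 = 2 * ‖z‖ ^ 2 := by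
  simp only [EuclideanSpace.norm_sq_eq, Fin.sum_univ_four, ← Complex.normSq_eq_norm_sq,
    Complex.normSq_apply, wCoord]
  simp
  ring

namespace ResolvedConifold

theorem hasFDerivAt_bundleVec (i : Fin 2) (y : ℂ × ℂ × ℂ) :
    HasFDerivAt (bundleVec i) (fderiv ℝ (bundleVec i) y) y :=
  ((contDiff_bundleVec_real i).differentiable (by simp) y).hasFDerivAt

theorem fderiv_bundleVec_I_smul (i : Fin 2) (y X : ℂ × ℂ × ℂ) :
    fderiv ℝ (bundleVec i) y (I • X) = I • fderiv ℝ (bundleVec i) y X := by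
  rw [((contDiff_bundleVec i).differentiable (by simp) y).fderiv_restrictScalars ℝ]
  exact map_smul (fderiv ℂ (bundleVec i) y) I X

theorem wCoord_bundleVec_castAdd (i : Fin 2) (y : ℂ × ℂ × ℂ) (l : Fin 2) :
    wCoord (bundleVec i y) (Fin.castAdd 2 l) = y.2.1 * affineVec i y.1 l := by
  rw [bundleVec, wCoord_ofW]
  fin_cases l <;> rfl

theorem wCoord_bundleVec_natAdd (i : Fin 2) (y : ℂ × ℂ × ℂ) (l : Fin 2) :
    wCoord (bundleVec i y) (Fin.natAdd 2 l) = y.2.2 * affineVec i y.1 l := by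
  rw [bundleVec, wCoord_ofW]
  fin_cases l <;> rfl

/-- In a chart with coordinates $(c,a,b)$ the $w$-coordinates are $a, ac, b, bc$ up to order; this
is the product rule. -/
theorem wCoord_fderiv_bundleVec (i : Fin 2) (y X : ℂ × ℂ × ℂ) :
    wCoord (fderiv ℝ (bundleVec i) y X) (Fin.castAdd 2 i) = X.2.1 ∧
    wCoord (fderiv ℝ (bundleVec i) y X) (Fin.castAdd 2 (i + 1)) = X.2.1 * y.1 + y.2.1 * X.1 ∧
    wCoord (fderiv ℝ (bundleVec i) y X) (Fin.natAdd 2 i) = X.2.2 ∧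
    wCoord (fderiv ℝ (bundleVec i) y X) (Fin.natAdd 2 (i + 1)) = X.2.2 * y.1 + y.2.2 * X.1 := by
  have h (j : Fin 4) : HasFDerivAt (fun y => wCoord (bundleVec i y) j)
      (wCoordL j ∘L fderiv ℝ (bundleVec i) y) y :=
    (wCoordL j).hasFDerivAt.comp y (hasFDerivAt_bundleVec i y)
  have hi : i + 1 ≠ i := by fin_cases i <;> simp
  have h1 : HasFDerivAt (𝕜 := ℝ) (fun y : ℂ × ℂ × ℂ => y.1) (.fst ℝ ℂ (ℂ × ℂ)) y := hasFDerivAt_fst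
  have h2 : HasFDerivAt (𝕜 := ℝ) (fun y : ℂ × ℂ × ℂ => y.2.1)
      (.fst ℝ ℂ ℂ ∘L .snd ℝ ℂ (ℂ × ℂ)) y := hasFDerivAt_fst.comp y hasFDerivAt_snd
  have h3 : HasFDerivAt (𝕜 := ℝ) (fun y : ℂ × ℂ × ℂ => y.2.2)
      (.snd ℝ ℂ ℂ ∘L .snd ℝ ℂ (ℂ × ℂ)) y := hasFDerivAt_snd.comp y hasFDerivAt_snd
  have e1 := h (Fin.castAdd 2 i)
  have e2 := h (Fin.castAdd 2 (i + 1))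
  have e3 := h (Fin.natAdd 2 i)
  have e4 := h (Fin.natAdd 2 (i + 1))
  simp only [wCoord_bundleVec_castAdd, wCoord_bundleVec_natAdd, affineVec, if_true, mul_one,
    if_neg hi] at e1 e2 e3 e4
  refine ⟨?_, ?_, ?_, ?_⟩
  · exact DFunLike.congr_fun (e1.unique h2) X
  · refine (DFunLike.congr_fun (e2.unique (h2.mul h1)) X).trans ?_
    simp
    ring
  · exact DFunLike.congr_fun (e3.unique h3) X
  · refine (DFunLike.congr_fun (e4.unique (h3.mul h1)) X).trans ?_
    simp
    ring

theorem norm_sq_sub_mul_le (a b c : ℂ) :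
    ‖b - c * a‖ ^ 2 ≤ (1 + ‖c‖ ^ 2) * (‖a‖ ^ 2 + ‖b‖ ^ 2) := by
  have h : ‖b - c * a‖ ≤ ‖b‖ + ‖c‖ * ‖a‖ := (norm_sub_le _ _).trans_eq (by rw [norm_mul])
  nlinarith [sq_nonneg (‖c‖ * ‖b‖ - ‖a‖), norm_nonneg (b - c * a)]

theorem sum_fin_four_eq {i : Fin 2} (f : Fin 4 → ℝ) : ∑ j, f j =
    f (Fin.castAdd 2 i) + f (Fin.castAdd 2 (i + 1)) +
    (f (Fin.natAdd 2 i) + f (Fin.natAdd 2 (i + 1))) := by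
  fin_cases i <;> simp [Fin.sum_univ_four] <;> ring_nf

/-- With $w=(a,ac,b,bc)$ and derivative $(a',a'c+ac',b',b'c+bc')$, subtracting $c$ times the first
entry of each pair isolates $ac'$ and $bc'$. Cauchy–Schwarz bounds them at the cost of a factor
$1+|c|^2$. Since $2|z|^2=(|a|^2+|b|^2)(1+|c|^2)$, this says that the Fubini–Study part is at most
$|Z|^2/|z|^2$. -/
theorem norm_sq_bundleVec_mul_le (i : Fin 2) (y X : ℂ × ℂ × ℂ) :
    ‖bundleVec i y‖ ^ 2 * (‖X.1‖ ^ 2 / (1 + ‖y.1‖ ^ 2) ^ 2) ≤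
      ‖fderiv ℝ (bundleVec i) y X‖ ^ 2 := by
  obtain ⟨h1, h2, h3, h4⟩ := wCoord_fderiv_bundleVec i y X
  have hi : i + 1 ≠ i := by fin_cases i <;> simp
  have hw := sum_norm_sq_wCoord (bundleVec i y)
  have hW := sum_norm_sq_wCoord (fderiv ℝ (bundleVec i) y X)
  rw [sum_fin_four_eq (i := i)] at hw hW
  rw [h1, h2, h3, h4] at hW
  simp only [wCoord_bundleVec_castAdd, wCoord_bundleVec_natAdd, affineVec, if_true, mul_one,
    if_neg hi, norm_mul, mul_pow] at hw
  have e1 := norm_sq_sub_mul_le X.2.1 (X.2.1 * y.1 + y.2.1 * X.1) y.1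
  have e2 := norm_sq_sub_mul_le X.2.2 (X.2.2 * y.1 + y.2.2 * X.1) y.1
  rw [show X.2.1 * y.1 + y.2.1 * X.1 - y.1 * X.2.1 = y.2.1 * X.1 by ring, norm_mul, mul_pow] at e1
  rw [show X.2.2 * y.1 + y.2.2 * X.1 - y.1 * X.2.2 = y.2.2 * X.1 by ring, norm_mul, mul_pow] at e2
  have hpos : 0 < 1 + ‖y.1‖ ^ 2 := by positivity
  rw [← mul_div_assoc, div_le_iff₀ (by positivity)]
  nlinarith

theorem metric_self (q : ResolvedConifold) (X : ℂ × ℂ × ℂ) :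
    metric q X X = ‖X.1‖ ^ 2 / (1 + ‖(chart q.proj₁.index q).1‖ ^ 2) ^ 2 +
      ‖fderiv ℝ (bundleVec q.proj₁.index) (chart q.proj₁.index q) X‖ ^ 2 := by
  have h1 : metric q X X = (inner ℂ X.1 X.1).re /
      (1 + ‖(chart q.proj₁.index q).1‖ ^ 2) ^ 2 +
      (inner ℂ (fderiv ℝ (bundleVec q.proj₁.index) (chart q.proj₁.index q) X)
        (fderiv ℝ (bundleVec q.proj₁.index) (chart q.proj₁.index q) X)).re := by
    unfold metric
    rw [mfderiv_proj₁, mfderiv_proj₂]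
    rfl
  rw [h1, inner_self_eq_norm_sq_to_K, inner_self_eq_norm_sq_to_K]
  norm_cast

theorem norm_sq_le_metric (q : ResolvedConifold) (X : ℂ × ℂ × ℂ) :
    ‖fderiv ℝ (bundleVec q.proj₁.index) (chart q.proj₁.index q) X‖ ^ 2 ≤ metric q X X := by
  rw [metric_self]
  have : 0 ≤ ‖X.1‖ ^ 2 / (1 + ‖(chart q.proj₁.index q).1‖ ^ 2) ^ 2 := by positivity
  linarith

theorem metric_le {δ : ℝ} (hδ : 0 < δ) {q : ResolvedConifold} (hq : δ ≤ ‖q.proj₂‖)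
    (X : ℂ × ℂ × ℂ) : metric q X X ≤ (1 + (δ ^ 2)⁻¹) *
      ‖fderiv ℝ (bundleVec q.proj₁.index) (chart q.proj₁.index q) X‖ ^ 2 := by
  rw [metric_self]
  have h := norm_sq_bundleVec_mul_le q.proj₁.index (chart q.proj₁.index q) X
  rw [← proj₂_eq_bundleVec (i := q.proj₁.index) (q := q) q.proj₁.hom_index_ne_zero] at h
  set A := ‖X.1‖ ^ 2 / (1 + ‖(chart q.proj₁.index q).1‖ ^ 2) ^ 2 with hA
  have hA0 : 0 ≤ A := by positivity
  have h2 : A * δ ^ 2 ≤ ‖fderiv ℝ (bundleVec q.proj₁.index) (chart q.proj₁.index q) X‖ ^ 2 := by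
    refine le_trans ?_ h
    rw [mul_comm]
    gcongr
  have h3 := (le_div_iff₀ (by positivity : 0 < δ ^ 2)).2 h2
  rw [div_eq_inv_mul] at h3
  linarith

/-- The Fubini–Study term detects the base direction. On vertical vectors the differential of π₂ is
injective, even over the zero section. -/
theorem metric_self_pos (q : ResolvedConifold) {X : ℂ × ℂ × ℂ} (hX : X ≠ 0) :
    0 < metric q X X := by
  rw [metric_self]
  by_cases h : X.1 = 0
  · have h2 : fderiv ℝ (bundleVec q.proj₁.index) (chart q.proj₁.index q) X ≠ 0 := by
      intro h0
      obtain ⟨h1, -, h3, -⟩ := wCoord_fderiv_bundleVec q.proj₁.index (chart q.proj₁.index q) X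
      rw [h0, ← wCoordL_apply, map_zero] at h1 h3
      exact hX (Prod.ext h (Prod.ext h1.symm h3.symm))
    positivity
  · positivity

end ResolvedConifold

/-! ### Taming and nondegeneracy. -/

open ResolvedConifold

theorem rePart_I_smul (z : C4) : rePart (I • z) = -imPart z := by
  ext j; simp [rePart, imPart]

theorem imPart_I_smul (z : C4) : imPart (I • z) = rePart z := by
  ext j; simp [rePart, imPart]

theorem perturbedForm_apply (ξ : R4 → R4) (ε : ℝ) (q : ResolvedConifold)
    (X Y : TangentSpace 𝓘(ℝ, ℂ × ℂ × ℂ) q) :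
    perturbedForm ξ ε q ![X, Y] = pushforward (shear ξ ε) (fun _ => stdForm) q.proj₂
      ![mfderiv 𝓘(ℝ, ℂ × ℂ × ℂ) 𝓘(ℝ, C4) proj₂ q X,
        mfderiv 𝓘(ℝ, ℂ × ℂ × ℂ) 𝓘(ℝ, C4) proj₂ q Y] :=
  compContinuousLinearMap_pair (E := ℂ × ℂ × ℂ) (F := C4) _ _ _ _

/-- The skew-symmetric part (doubled) of the derivative of a vector field. -/
def curl (ξ : R4 → R4) (x : R4) : R4 →L[ℝ] R4 :=
  fderiv ℝ ξ x - (fderiv ℝ ξ x).adjoint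

/-- The symmetric part of the derivative of ξ drops out; only its skew part can spoil taming. -/
theorem pushforward_shear_I_smul {ξ : R4 → R4} (hξ : Differentiable ℝ ξ) (ε : ℝ) (z X : C4) :
    pushforward (shear ξ ε) (fun _ => stdForm) z ![X, I • X] =
      ‖X‖ ^ 2 - ε * inner ℝ (curl ξ (rePart z) (rePart X)) (imPart X) := by
  rw [pushforward_shear_apply hξ, norm_sq_eq_rePart_imPart, rePart_I_smul, imPart_I_smul, curl]
  simp only [inner_sub_right, inner_neg_left, inner_smul_right, map_neg, smul_neg, inner_neg_right,
    real_inner_self_eq_norm_sq, _root_.sub_apply, inner_sub_left,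
    ContinuousLinearMap.adjoint_inner_left]
  rw [real_inner_comm (imPart X) (fderiv ℝ ξ (rePart z) (rePart X))]
  ring

/-- By $|\mathrm{Re}\,X||\mathrm{Im}\,X|\le|X|^2/2$, a bound $3/2$ on $\varepsilon\|\mathrm{curl}\|$
gives an error of at most $3/4$. Any constant strictly between 1 and 2 would serve in place of
$3/2$. -/
theorem abs_pushforward_shear_sub_le {ξ : R4 → R4} (hξ : Differentiable ℝ ξ) {ε : ℝ} (hε : 0 < ε)
    {z : C4} (hz : ε * ‖curl ξ (rePart z)‖ ≤ 3 / 2) (X : C4) :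
    |pushforward (shear ξ ε) (fun _ => stdForm) z ![X, I • X] - ‖X‖ ^ 2| ≤ 3 / 4 * ‖X‖ ^ 2 := by
  rw [pushforward_shear_I_smul hξ, sub_sub_cancel_left, abs_neg, abs_mul, abs_of_pos hε]
  have h1 : |inner ℝ (curl ξ (rePart z) (rePart X)) (imPart X)| ≤
      ‖curl ξ (rePart z)‖ * ‖rePart X‖ * ‖imPart X‖ :=
    (abs_real_inner_le_norm _ _).trans (by gcongr; exact ContinuousLinearMap.le_opNorm _ _)
  rw [norm_sq_eq_rePart_imPart]
  have h2 : ε * ‖curl ξ (rePart z)‖ * (‖rePart X‖ * ‖imPart X‖) ≤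
      3 / 2 * (‖rePart X‖ * ‖imPart X‖) := by gcongr
  have h3 := mul_le_mul_of_nonneg_left h1 hε.le
  nlinarith [sq_nonneg (‖rePart X‖ - ‖imPart X‖)]

theorem perturbedForm_uniformlyTameOn {ξ : R4 → R4} (hξ : Differentiable ℝ ξ) {ε δ : ℝ}
    (hε : 0 < ε) (hδ : 0 < δ) {U : Set ResolvedConifold}
    (hU : ∀ q ∈ U, ε * ‖curl ξ (rePart q.proj₂)‖ ≤ 3 / 2 ∧ δ ≤ ‖q.proj₂‖) :
    (perturbedForm ξ ε).UniformlyTameOn J metric U := by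
  have hδ' : 0 < (δ ^ 2)⁻¹ := by positivity
  -- The form lies between $1/4$ and $7/4$ of $|Z|^2$, where $|Z|^2\le\widehat
  -- g\le(1+\delta^{-2})|Z|^2$.
  refine ⟨4 * (1 + (δ ^ 2)⁻¹), by linarith, fun q hq (X : ℂ × ℂ × ℂ) => ?_⟩
  obtain ⟨h1, h2⟩ := hU q hq
  have hJ : mfderiv 𝓘(ℝ, ℂ × ℂ × ℂ) 𝓘(ℝ, C4) proj₂ q (J q X) =
      I • (fderiv ℝ (bundleVec q.proj₁.index) (chart q.proj₁.index q) X) := by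
    rw [mfderiv_proj₂]
    exact fderiv_bundleVec_I_smul _ _ _
  have h3 := abs_pushforward_shear_sub_le hξ hε h1
    (fderiv ℝ (bundleVec q.proj₁.index) (chart q.proj₁.index q) X)
  have h4 := norm_sq_le_metric q X
  have h5 := metric_le hδ h2 X
  have key : perturbedForm ξ ε q ![X, J q X] =
      pushforward (shear ξ ε) (fun _ => stdForm) q.proj₂
      ![fderiv ℝ (bundleVec q.proj₁.index) (chart q.proj₁.index q) X,
        I • fderiv ℝ (bundleVec q.proj₁.index) (chart q.proj₁.index q) X] := by
    refine (perturbedForm_apply ξ ε q X (J q X)).trans ?_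
    rw [hJ, mfderiv_proj₂]
    rfl
  rw [abs_le] at h3
  rw [key]
  constructor
  · rw [inv_mul_le_iff₀ (by positivity)]
    nlinarith
  · nlinarith [sq_nonneg ‖fderiv ℝ (bundleVec q.proj₁.index) (chart q.proj₁.index q) X‖]

theorem nondegenerate_of_uniformlyTameOn {ξ : R4 → R4} {ε : ℝ} {U : Set ResolvedConifold}
    (h : (perturbedForm ξ ε).UniformlyTameOn J metric U) :
    ∀ q ∈ U, ∀ X : TangentSpace 𝓘(ℝ, ℂ × ℂ × ℂ) q, X ≠ 0 → ∃ Y, perturbedForm ξ ε q ![X, Y] ≠ 0 := by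
  obtain ⟨C, hC, h⟩ := h
  intro q hq X hX
  refine ⟨J q X, ne_of_gt (lt_of_lt_of_le ?_ (h q hq X).1)⟩
  have := metric_self_pos q hX
  positivity

/-! ### Inverse functions and extension of jets. -/

/-- The inverse function theorem, with a smooth inverse on an open set. -/
theorem exists_openPartialHomeomorph_of_contDiffOn {E F : Type*} [NormedAddCommGroup E]
    [NormedSpace ℝ E] [CompleteSpace E] [NormedAddCommGroup F] [NormedSpace ℝ F]
    {h : E → F} {O : Set E} (hO : IsOpen O) (hh : ContDiffOn ℝ ∞ h O) {a : E} (ha : a ∈ O)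
    {h' : E ≃L[ℝ] F} (hh' : HasFDerivAt h (h' : E →L[ℝ] F) a) :
    ∃ e : OpenPartialHomeomorph E F, a ∈ e.source ∧ e.source ⊆ O ∧ (e : E → F) = h ∧
      ContDiffOn ℝ ∞ e.symm e.target := by
  have hAt (y : E) (hy : y ∈ O) : ContDiffAt ℝ ∞ h y := hh.contDiffAt (hO.mem_nhds hy)
  let e₀ := (hAt a ha).toOpenPartialHomeomorph h hh' (by simp)
  -- Invertibility of the derivative is an open condition. Restricting to where it holds makes the
  -- inverse smooth on the whole target, not only at one point.
  let S : Set E := O ∩ fderiv ℝ h ⁻¹' (range ((↑) : (E ≃L[ℝ] F) → E →L[ℝ] F))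
  have hS : IsOpen S := (hh.continuousOn_fderiv_of_isOpen hO (by simp)).isOpen_inter_preimage hO
    ContinuousLinearEquiv.isOpen
  refine ⟨e₀.restrOpen S hS, ?_, ?_, rfl, ?_⟩
  · rw [OpenPartialHomeomorph.restrOpen_source]
    exact ⟨(hAt a ha).mem_toOpenPartialHomeomorph_source hh' (by simp), ha, h', hh'.fderiv.symm⟩
  · rw [OpenPartialHomeomorph.restrOpen_source]
    exact fun y hy => hy.2.1
  · intro b hb
    have hb' := (e₀.restrOpen S hS).map_target hb
    rw [OpenPartialHomeomorph.restrOpen_source] at hb'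
    obtain ⟨hb1, hb2, f', hf'⟩ := hb'
    have hd : HasFDerivAt h (f' : E →L[ℝ] F) ((e₀.restrOpen S hS).symm b) := by
      rw [hf']
      exact ((hAt _ hb2).differentiableAt (by simp)).hasFDerivAt
    exact ((e₀.restrOpen S hS).contDiffAt_symm hb hd (hAt _ hb2)).contDiffWithinAt

/-- Extension of a family of 1-jets to a smooth function, when this is possible locally. -/
theorem exists_contDiff_of_local_jets {E F ι : Type*} [NormedAddCommGroup E] [NormedSpace ℝ E]
    [FiniteDimensional ℝ E] [NormedAddCommGroup F] [NormedSpace ℝ F]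
    (p : ι → E) (a : ι → F) (b : ι → E →L[ℝ] F)
    (hloc : ∀ x, ∃ U : Set E, IsOpen U ∧ x ∈ U ∧ ∃ g : E → F, ContDiffOn ℝ ∞ g U ∧
      ∀ t, p t ∈ U → g (p t) = a t ∧ HasFDerivAt g (b t) (p t)) :
    ∃ g : E → F, ContDiff ℝ ∞ g ∧ ∀ t, g (p t) = a t ∧ HasFDerivAt g (b t) (p t) := by
  choose U hU hxU g hg hgp using hloc
  obtain ⟨ρ, hρ⟩ := SmoothPartitionOfUnity.exists_isSubordinate 𝓘(ℝ, E) (isClosed_univ (X := E))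
    U hU fun x _ => mem_iUnion.2 ⟨x, hxU x⟩
  refine ⟨fun x => ∑ᶠ i, ρ i x • g i x, ?_, fun t => ?_⟩
  · exact (hρ.contMDiff_finsum_smul hU fun i => (hg i).contMDiffOn).contDiff
  -- Having a prescribed 1-jet is a convex condition: a partition-of-unity average of points within
  -- `c` of `y` is within `c` of `y`. Used with `c = 0` for the value, and with `y` the first-order
  -- Taylor polynomial for the derivative; no derivative of the weights enters.
  have key (c : ℝ) (x : E) (y : F) (h : ∀ i ∈ ρ.finsupport x, ‖g i x - y‖ ≤ c) :
      ‖∑ᶠ i, ρ i x • g i x - y‖ ≤ c := by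
    rw [← mem_closedBall_iff_norm]
    refine ρ.finsum_smul_mem_convex (mem_univ x) (fun i hi => ?_) (convex_closedBall y c)
    rw [mem_closedBall_iff_norm]
    exact h i ((ρ.mem_finsupport x).2 hi)
  have hsub (i) (hi : i ∈ ρ.fintsupport (p t)) : p t ∈ U i :=
    hρ i ((ρ.mem_fintsupport_iff _ i).1 hi)
  have hval : ∑ᶠ i, ρ i (p t) • g i (p t) = a t := by
    have := key 0 (p t) (a t) fun i hi => by
      rw [(hgp i t (hsub i (ρ.finsupport_subset_fintsupport _ hi))).1, sub_self, norm_zero]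
    rwa [norm_le_zero_iff, sub_eq_zero] at this
  refine ⟨hval, ?_⟩
  rw [hasFDerivAt_iff_isLittleO, Asymptotics.isLittleO_iff]
  intro c hc
  have h1 : ∀ᶠ x in 𝓝 (p t), ∀ i ∈ ρ.fintsupport (p t),
      ‖g i x - (a t + b t (x - p t))‖ ≤ c * ‖x - p t‖ := by
    rw [Filter.eventually_all_finset]
    intro i hi
    obtain ⟨e1, e2⟩ := hgp i t (hsub i hi)
    rw [hasFDerivAt_iff_isLittleO, Asymptotics.isLittleO_iff] at e2
    filter_upwards [e2 hc] with x hx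
    rwa [e1, sub_sub] at hx
  filter_upwards [h1, ρ.eventually_finsupport_subset (p t)] with x hx hx'
  rw [hval, sub_sub]
  exact key _ x _ fun i hi => hx i (hx' hi)

open InnerProductSpace

/-! ### Moving-frame relations and local parameters of a knot. -/

namespace Knot

variable (k : Knot)

/-- The unit tangent vector. -/
def tangent (t : ℝ) : R4 := deriv k.toFun t

/-- The acceleration. -/
def accel (t : ℝ) : R4 := deriv k.tangent t

theorem contDiff_tangent : ContDiff ℝ ∞ k.tangent :=
  (contDiff_infty_iff_deriv.1 k.smooth).2

theorem contDiff_accel : ContDiff ℝ ∞ k.accel :=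
  (contDiff_infty_iff_deriv.1 k.contDiff_tangent).2

theorem hasDerivAt (t : ℝ) : HasDerivAt k.toFun (k.tangent t) t :=
  (k.smooth.differentiable (by simp) t).hasDerivAt

theorem hasDerivAt_tangent (t : ℝ) : HasDerivAt k.tangent (k.accel t) t :=
  (k.contDiff_tangent.differentiable (by simp) t).hasDerivAt

theorem norm_tangent (t : ℝ) : ‖k.tangent t‖ = 1 := k.unit_speed t

theorem inner_self (t : ℝ) : inner ℝ (k.toFun t) (k.toFun t) = 1 := by
  rw [real_inner_self_eq_norm_sq, k.norm_eq_one, one_pow]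

theorem inner_tangent_self (t : ℝ) : inner ℝ (k.tangent t) (k.tangent t) = 1 := by
  rw [real_inner_self_eq_norm_sq, k.norm_tangent, one_pow]

theorem inner_tangent (t : ℝ) : inner ℝ (k.toFun t) (k.tangent t) = 0 := by
  have h := (k.hasDerivAt t).inner ℝ (k.hasDerivAt t)
  have h' : HasDerivAt (fun t => inner ℝ (k.toFun t) (k.toFun t)) 0 t := by
    simp only [k.inner_self]
    exact hasDerivAt_const t 1
  have := h.unique h'
  rw [real_inner_comm (k.toFun t)] at this
  linarith

theorem inner_tangent_accel (t : ℝ) : inner ℝ (k.tangent t) (k.accel t) = 0 := by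
  have h := (k.hasDerivAt_tangent t).inner ℝ (k.hasDerivAt_tangent t)
  have h' : HasDerivAt (fun t => inner ℝ (k.tangent t) (k.tangent t)) 0 t := by
    simp only [k.inner_tangent_self]
    exact hasDerivAt_const t 1
  have := h.unique h'
  rw [real_inner_comm (k.tangent t)] at this
  linarith

theorem inner_accel (t : ℝ) : inner ℝ (k.toFun t) (k.accel t) = -1 := by
  have h := (k.hasDerivAt t).inner ℝ (k.hasDerivAt_tangent t)
  have h' : HasDerivAt (fun t => inner ℝ (k.toFun t) (k.tangent t)) 0 t := by
    simp only [k.inner_tangent]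
    exact hasDerivAt_const t 0
  have := h.unique h'
  rw [k.inner_tangent_self] at this
  linarith

theorem periodic_tangent : Function.Periodic k.tangent k.length := fun t => by
  rw [tangent, ← deriv_comp_add_const]
  congr 1
  exact funext k.periodic

theorem periodic_accel : Function.Periodic k.accel k.length := fun t => by
  rw [accel, ← deriv_comp_add_const]
  congr 1
  exact funext k.periodic_tangent

theorem toIcoMod_eq (a t : ℝ) : toIcoMod k.length_pos a t =
    t + ((-toIcoDiv k.length_pos a t : ℤ) : ℝ) * k.length := by
  rw [toIcoMod, zsmul_eq_mul]
  push_cast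
  ring

theorem toFun_toIcoMod (a t : ℝ) : k.toFun (toIcoMod k.length_pos a t) = k.toFun t := by
  rw [k.toIcoMod_eq]
  exact k.periodic.int_mul _ _

theorem exists_int_of_eq {s t : ℝ} (h : k.toFun s = k.toFun t) : ∃ n : ℤ, s = t + n * k.length := by
  rw [← k.toFun_toIcoMod 0 s, ← k.toFun_toIcoMod 0 t] at h
  have h' (s : ℝ) : toIcoMod k.length_pos 0 s ∈ Ico 0 k.length := by
    simpa using toIcoMod_mem_Ico k.length_pos 0 s
  have := k.injOn (h' s) (h' t) h
  rw [k.toIcoMod_eq, k.toIcoMod_eq] at this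
  refine ⟨-toIcoDiv k.length_pos 0 t + toIcoDiv k.length_pos 0 s, ?_⟩
  push_cast at this ⊢
  linarith

/-- Injectivity and compactness: the arc of parameters at distance at least δ/2 from `t₀` modulo the
period has compact image missing `k t₀`. Hence distant strands of the knot do not return near this
point. -/
theorem exists_ball (t₀ : ℝ) {δ : ℝ} (hδ : 0 < δ) : ∃ ρ > 0, ∀ t,
    k.toFun t ∈ Metric.ball (k.toFun t₀) ρ →
      ∃ n : ℤ, t + n * k.length ∈ Metric.ball t₀ δ := by
  have hK : IsCompact (Icc (t₀ + δ / 2) (t₀ + k.length - δ / 2)) := isCompact_Icc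
  have hK' := (hK.image k.smooth.continuous).isClosed
  have hmem : k.toFun t₀ ∈ (k.toFun '' Icc (t₀ + δ / 2) (t₀ + k.length - δ / 2))ᶜ := by
    rintro ⟨s, ⟨hs1, hs2⟩, hs⟩
    obtain ⟨n, hn⟩ := k.exists_int_of_eq hs
    have hl := k.length_pos
    have h1 : (0 : ℝ) < n := by
      by_contra! h
      nlinarith
    have h2 : (n : ℝ) < 1 := by
      by_contra! h
      nlinarith
    norm_cast at h1 h2
    omega
  obtain ⟨ρ, hρ, h⟩ := Metric.isOpen_iff.1 hK'.isOpen_compl _ hmem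
  refine ⟨ρ, hρ, fun t ht => ?_⟩
  have h1 := toIcoMod_mem_Ico k.length_pos (t₀ - δ / 2) t
  refine ⟨-toIcoDiv k.length_pos (t₀ - δ / 2) t, ?_⟩
  rw [← k.toIcoMod_eq]
  rw [← k.toFun_toIcoMod (t₀ - δ / 2) t] at ht
  have h4 : ¬ t₀ + δ / 2 ≤ toIcoMod k.length_pos (t₀ - δ / 2) t := fun h5 =>
    h ht ⟨_, ⟨h5, by linarith [h1.2]⟩, rfl⟩
  rw [Metric.mem_ball, Real.dist_eq, abs_lt]
  constructor <;> linarith [h1.1]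

/-- A smooth extension of the parameter of the knot to a neighbourhood of one of its points. -/
theorem exists_parameter (t₀ : ℝ) : ∃ U : Set R4, IsOpen U ∧ k.toFun t₀ ∈ U ∧ ∃ τ : R4 → ℝ,
    ContDiffOn ℝ ∞ τ U ∧ (∀ t, k.toFun t ∈ U → ∃ n : ℤ, τ (k.toFun t) = t + n * k.length) ∧
    τ (k.toFun t₀) = t₀ ∧
    ∀ x ∈ U, inner ℝ (k.tangent t₀) (k.toFun (τ x)) = inner ℝ (k.tangent t₀) x := by
  -- Projection to the tangent line has derivative 1 at `t₀` along the knot, so its local inverse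
  -- extends the parameter to nearby points of ℝ⁴.
  let h : ℝ → ℝ := fun t => inner ℝ (k.tangent t₀) (k.toFun t)
  have hh : ContDiff ℝ ∞ h := contDiff_const.inner ℝ k.smooth
  have hd : HasDerivAt h 1 t₀ := by
    have := (hasDerivAt_const t₀ (k.tangent t₀)).inner ℝ (k.hasDerivAt t₀)
    rwa [k.inner_tangent_self, inner_zero_left, add_zero] at this
  obtain ⟨e, he1, -, he2, he3⟩ := exists_openPartialHomeomorph_of_contDiffOn isOpen_univ
    hh.contDiffOn (mem_univ t₀) (hd.hasFDerivAt_equiv one_ne_zero)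
  obtain ⟨δ, hδ, hball⟩ := Metric.isOpen_iff.1 e.open_source t₀ he1
  obtain ⟨ρ, hρ, hρ'⟩ := k.exists_ball t₀ hδ
  have hc : Continuous fun x : R4 => (inner ℝ (k.tangent t₀) x : ℝ) := by fun_prop
  refine ⟨Metric.ball (k.toFun t₀) ρ ∩ (fun x => inner ℝ (k.tangent t₀) x) ⁻¹' e.target,
    Metric.isOpen_ball.inter (e.open_target.preimage hc), ⟨Metric.mem_ball_self hρ, ?_⟩,
    fun x => e.symm (inner ℝ (k.tangent t₀) x), ?_, ?_, ?_, ?_⟩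
  · have := e.map_source he1
    rwa [he2] at this
  · exact he3.comp (contDiff_const.inner ℝ contDiff_id).contDiffOn fun x hx => hx.2
  · rintro t ⟨ht, -⟩
    obtain ⟨n, hn⟩ := hρ' t ht
    refine ⟨n, ?_⟩
    have := e.left_inv (hball hn)
    rw [he2] at this
    rw [← this]
    change e.symm (h t) = e.symm (h (t + n * k.length))
    simp only [h]
    rw [k.periodic.int_mul]
  · have := e.left_inv he1
    rwa [he2] at this
  · rintro x ⟨-, hx⟩
    have := e.right_inv hx
    rw [he2] at this
    exact this

/-- The condition `hab` is the necessary compatibility along the knot. It suffices: locally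
$a(\tau(x))+b(\tau(x))(x-k(\tau(x)))$ works, since the terms $a'\,d\tau$ and $-b(\dot k)\,d\tau$ of
its derivative on the knot cancel. -/
theorem exists_jet_extension {F : Type*} [NormedAddCommGroup F] [NormedSpace ℝ F]
    {a a' : ℝ → F} {b : ℝ → R4 →L[ℝ] F} (ha : ContDiff ℝ ∞ a) (hb : ContDiff ℝ ∞ b)
    (ha' : ∀ t, HasDerivAt a (a' t) t)
    (hap : Function.Periodic a k.length) (hbp : Function.Periodic b k.length)
    (hab : ∀ t, b t (k.tangent t) = a' t) :
    ∃ g : R4 → F, ContDiff ℝ ∞ g ∧ ∀ t, g (k.toFun t) = a t ∧ HasFDerivAt g (b t) (k.toFun t) := by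
  refine exists_contDiff_of_local_jets k.toFun a b fun x => ?_
  by_cases hx : x ∈ range k.toFun
  · obtain ⟨t₀, rfl⟩ := hx
    obtain ⟨U, hU, hxU, τ, hτ, hτk, -, -⟩ := k.exists_parameter t₀
    refine ⟨U, hU, hxU, fun x => a (τ x) + b (τ x) (x - k.toFun (τ x)), ?_, fun t ht => ?_⟩
    · exact (ha.comp_contDiffOn hτ).add ((hb.comp_contDiffOn hτ).clm_apply
        (contDiffOn_id.sub (k.smooth.comp_contDiffOn hτ)))
    · obtain ⟨n, hn⟩ := hτk t ht
      have e1 : a (τ (k.toFun t)) = a t := by rw [hn, hap.int_mul]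
      have e2 : b (τ (k.toFun t)) = b t := by rw [hn, hbp.int_mul]
      have e3 : k.toFun (τ (k.toFun t)) = k.toFun t := by rw [hn, k.periodic.int_mul]
      have e4 : k.tangent (τ (k.toFun t)) = k.tangent t := by rw [hn, k.periodic_tangent.int_mul]
      have dτ : HasFDerivAt τ (fderiv ℝ τ (k.toFun t)) (k.toFun t) :=
        ((hτ.contDiffAt (hU.mem_nhds ht)).differentiableAt (by simp)).hasFDerivAt
      refine ⟨by simp only [e1, e3, sub_self, map_zero, add_zero], ?_⟩
      have d1 := (ha' (τ (k.toFun t))).hasFDerivAt.comp (k.toFun t) dτ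
      have d2 := (hb.differentiable (by simp) (τ (k.toFun t))).hasFDerivAt.comp (k.toFun t) dτ
      have d3 := (k.hasDerivAt (τ (k.toFun t))).hasFDerivAt.comp (k.toFun t) dτ
      refine (d1.add (d2.clm_apply ((hasFDerivAt_id _).sub d3))).congr_fderiv ?_
      ext v : 1
      have e5 : deriv b (τ (k.toFun t)) (k.toFun (τ (k.toFun t))) =
        deriv b (τ (k.toFun t)) (k.toFun t) := by rw [e3]
      simp [← hab, e2, e4, e5]
  · refine ⟨(range k.toFun)ᶜ, ?_, hx, 0, contDiff_const.contDiffOn,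
      fun t ht => absurd (mem_range_self t) ht⟩
    rw [← k.periodic.image_Icc k.length_pos 0]
    exact (isCompact_Icc.image k.smooth.continuous).isClosed.isOpen_compl

end Knot

/-! ### The prescribed derivative of the vector field. -/

namespace Knot

variable (k : Knot)

/-- The derivative at the point `k t` of a 0-homogeneous vector field extending the unit tangent
vector; it is symmetric up to its component along the knot and the radial direction. -/
def tangentJet (t : ℝ) : R4 →L[ℝ] R4 :=
  rankOne ℝ (k.accel t) (k.tangent t) + rankOne ℝ (k.tangent t) (k.accel t) +
    rankOne ℝ (k.tangent t) (k.toFun t)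

theorem tangentJet_apply (t : ℝ) (v : R4) : k.tangentJet t v =
    inner ℝ (k.tangent t) v • k.accel t + inner ℝ (k.accel t) v • k.tangent t +
      inner ℝ (k.toFun t) v • k.tangent t := rfl

theorem contDiff_tangentJet : ContDiff ℝ ∞ k.tangentJet := by
  have h {f g : ℝ → R4} (hf : ContDiff ℝ ∞ f) (hg : ContDiff ℝ ∞ g) :
      ContDiff ℝ ∞ fun t => rankOne ℝ (f t) (g t) :=
    ((innerSL ℝ (E := R4)).contDiff.comp hg).smulRight hf
  exact ((h k.contDiff_accel k.contDiff_tangent).add (h k.contDiff_tangent k.contDiff_accel)).add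
    (h k.contDiff_tangent k.smooth)

theorem periodic_tangentJet : Function.Periodic k.tangentJet k.length := fun t => by
  rw [tangentJet, k.periodic, k.periodic_tangent, k.periodic_accel, tangentJet]

theorem tangentJet_tangent (t : ℝ) : k.tangentJet t (k.tangent t) = k.accel t := by
  rw [tangentJet_apply, k.inner_tangent_self, real_inner_comm, k.inner_tangent_accel,
    k.inner_tangent]
  simp

/-- Compatibility with homogeneity of degree 0: the third term of the jet is there to cancel
$\langle\ddot k,k\rangle\dot k=-\dot k$. -/
theorem tangentJet_self (t : ℝ) : k.tangentJet t (k.toFun t) = 0 := by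
  rw [tangentJet_apply, k.inner_self, real_inner_comm, k.inner_tangent, real_inner_comm,
    k.inner_accel]
  simp

/-- The first two terms of the jet are adjoint to each other, so only $\dot k\otimes k-k\otimes\dot
k$ remains: a quarter turn in the plane of $k,\dot k$ composed with projection to it. -/
theorem norm_tangentJet_sub_adjoint_le (t : ℝ) :
    ‖k.tangentJet t - (k.tangentJet t).adjoint‖ ≤ 1 := by
  have h : k.tangentJet t - (k.tangentJet t).adjoint =
      rankOne ℝ (k.tangent t) (k.toFun t) - rankOne ℝ (k.toFun t) (k.tangent t) := by
    simp only [tangentJet, map_add, adjoint_rankOne]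
    abel
  rw [h]
  refine ContinuousLinearMap.opNorm_le_bound _ zero_le_one fun v => ?_
  rw [one_mul]
  refine le_of_sq_le_sq ?_ (norm_nonneg _)
  have h1 : ‖v - (inner ℝ (k.toFun t) v • k.toFun t + inner ℝ (k.tangent t) v • k.tangent t)‖ ^ 2 =
      ‖v‖ ^ 2 - (inner ℝ (k.toFun t) v) ^ 2 - (inner ℝ (k.tangent t) v) ^ 2 := by
    simp only [← real_inner_self_eq_norm_sq, inner_sub_left, inner_sub_right, inner_add_left,
      inner_add_right, inner_smul_left, inner_smul_right, k.inner_self, k.inner_tangent_self,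
      k.inner_tangent, real_inner_comm (k.toFun t) (k.tangent t), real_inner_comm v]
    simp
    ring
  have h2 : ‖(rankOne ℝ (k.tangent t) (k.toFun t) - rankOne ℝ (k.toFun t) (k.tangent t)) v‖ ^ 2 =
      (inner ℝ (k.toFun t) v) ^ 2 + (inner ℝ (k.tangent t) v) ^ 2 := by
    simp only [_root_.sub_apply, rankOne_apply, ← real_inner_self_eq_norm_sq, inner_sub_left,
      inner_sub_right, inner_smul_left, inner_smul_right, k.inner_self, k.inner_tangent_self,
      k.inner_tangent, real_inner_comm (k.toFun t) (k.tangent t)]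
    simp
    ring
  rw [h2]
  nlinarith [sq_nonneg ‖v - (inner ℝ (k.toFun t) v • k.toFun t +
    inner ℝ (k.tangent t) v • k.tangent t)‖]

end Knot

/-! ### Construction of the vector field. -/

/-- A vector field that is homogeneous of degree zero outside a ball has bounded derivative. -/
theorem exists_bound_fderiv_of_homogeneous {E F : Type*} [NormedAddCommGroup E] [NormedSpace ℝ E]
    [FiniteDimensional ℝ E] [NormedAddCommGroup F] [NormedSpace ℝ F] {ξ : E → F}
    (hξ : ContDiff ℝ 1 ξ) {R : ℝ} (hR : 0 < R)
    (hom : ∀ (x : E) (c : ℝ), R ≤ ‖x‖ → 1 ≤ c → ξ (c • x) = ξ x) :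
    ∃ B : ℝ, ∀ x, ‖fderiv ℝ ξ x‖ ≤ B := by
  obtain ⟨B, hB⟩ := (isCompact_closedBall (0 : E) (2 * R)).exists_bound_of_continuousOn
    (hξ.continuous_fderiv (by simp)).continuousOn
  refine ⟨B, fun x => ?_⟩
  rcases le_or_gt ‖x‖ (2 * R) with h | h
  · exact hB x (mem_closedBall_zero_iff.2 h)
  have hx0 : 0 < ‖x‖ := by linarith
  set c : ℝ := ‖x‖ / (2 * R) with hc
  have hc1 : 1 ≤ c := (one_le_div (by positivity)).2 h.le
  have hc0 : 0 < c := by positivity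
  -- Rescaling to radius `2 * R` rather than `R` leaves a whole neighbourhood of `y` in the region
  -- of homogeneity, so that the relation can be differentiated.
  set y : E := c⁻¹ • x with hy
  have hxy : x = c • y := by rw [hy, smul_inv_smul₀ hc0.ne']
  have hyn : ‖y‖ = 2 * R := by
    rw [hy, norm_smul, norm_inv, Real.norm_of_nonneg hc0.le, hc]
    field_simp
  have h1 : HasFDerivAt (fun w => ξ (c • w)) (c • fderiv ℝ ξ x) y := by
    have e1 : HasFDerivAt ξ (fderiv ℝ ξ x) (c • y) :=
      hxy ▸ (hξ.differentiable (by simp) x).hasFDerivAt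
    have e2 : HasFDerivAt (fun w : E => c • w) (c • ContinuousLinearMap.id ℝ E) y :=
      (hasFDerivAt_id y).const_smul c
    refine (e1.comp y e2).congr_fderiv ?_
    ext v
    simp
  have h2 : (fun w => ξ (c • w)) =ᶠ[𝓝 y] ξ := by
    have : ∀ᶠ w : E in 𝓝 y, R < ‖w‖ :=
      (continuous_norm.tendsto y).eventually (lt_mem_nhds (by linarith))
    filter_upwards [this] with w hw
    exact hom w c hw.le hc1
  have h3 : fderiv ℝ ξ y = c • fderiv ℝ ξ x := (h1.congr_of_eventuallyEq h2.symm).fderiv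
  have h4 : ‖fderiv ℝ ξ y‖ ≤ B := hB y (mem_closedBall_zero_iff.2 hyn.le)
  rw [h3, norm_smul, Real.norm_of_nonneg hc0.le] at h4
  exact (le_mul_of_one_le_left (norm_nonneg _) hc1).trans h4

theorem hasFDerivAt_normalize {E : Type*} [NormedAddCommGroup E] [InnerProductSpace ℝ E] {u : E}
    (hu : ‖u‖ = 1) {r : ℝ} (hr : 0 < r) : HasFDerivAt (fun x : E => ‖x‖⁻¹ • x)
      (r⁻¹ • (ContinuousLinearMap.id ℝ E - rankOne ℝ u u)) (r • u) := by
  have hn : ‖r • u‖ = r := by rw [norm_smul, hu, mul_one, Real.norm_of_nonneg hr.le]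
  have h0 : r • u ≠ 0 := fun h => by rw [h, norm_zero] at hn; exact hr.ne hn
  have h1 : HasFDerivAt (fun x : E => ‖x‖) (innerSL ℝ u) (r • u) := by
    have h2 := (hasStrictFDerivAt_norm_sq (r • u)).hasFDerivAt.sqrt
      (by rw [hn]; positivity)
    simp only [Real.sqrt_sq (norm_nonneg _)] at h2
    refine h2.congr_fderiv ?_
    ext v
    simp [hn]
    field_simp
  have h3 := ((hasDerivAt_inv (x := ‖r • u‖) (by rw [hn]; exact hr.ne')).comp_hasFDerivAt
    (r • u) h1).smul (hasFDerivAt_id (r • u))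
  refine h3.congr_fderiv ?_
  ext v : 1
  simp only [Function.comp_apply, hn]
  simp only [_root_.add_apply, _root_.smul_apply,
    ContinuousLinearMap.smulRight_apply, ContinuousLinearMap.id_apply, rankOne_apply,
    innerSL_apply_apply, smul_smul, smul_sub, _root_.sub_apply, id, smul_eq_mul]
  rw [sub_eq_add_neg, ← neg_smul]
  congr 2
  field_simp

/-- The field is $\eta(x/|x|)$ cut off near the origin, where η realizes the jet along the knot. As
the jet kills $k$, the radial projection in the derivative of $x/|x|$ contributes nothing, and the
derivative at $r\,k(t)$ is $1/r$ times the jet. -/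
theorem Knot.exists_vectorField (k : Knot) {ε : ℝ} (hε : 0 < ε) : ∃ ξ : R4 → R4,
    ContDiff ℝ ∞ ξ ∧ (∃ B : ℝ, ∀ x, ‖fderiv ℝ ξ x‖ ≤ B) ∧
    (∀ t r, ε ≤ r → ξ (r • k.toFun t) = k.tangent t) ∧
    ∀ t r, ε ≤ r → ‖curl ξ (r • k.toFun t)‖ ≤ r⁻¹ := by
  obtain ⟨η, hη, hηk⟩ := k.exists_jet_extension k.contDiff_tangent k.contDiff_tangentJet
    k.hasDerivAt_tangent k.periodic_tangent k.periodic_tangentJet k.tangentJet_tangent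
  -- The cutoff is over already at radius ε/2, so the field agrees with $\eta(x/|x|)$ near every
  -- point of norm at least ε.
  let χ : ContDiffBump (0 : R4) := ⟨ε / 4, ε / 2, by positivity, by linarith⟩
  let ξ : R4 → R4 := fun x => (1 - χ x) • η (‖x‖⁻¹ • x)
  have hξ1 (x : R4) (hx : ε / 2 ≤ ‖x‖) : ξ x = η (‖x‖⁻¹ • x) := by
    have : χ x = 0 := χ.zero_of_le_dist (by rwa [dist_zero_right])
    simp only [ξ, this, sub_zero, one_smul]
  have hξ : ContDiff ℝ ∞ ξ := by
    rw [contDiff_iff_contDiffAt]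
    intro x
    by_cases hx : x = 0
    · refine (contDiffAt_const (c := 0)).congr_of_eventuallyEq ?_
      rw [hx]
      filter_upwards [χ.eventuallyEq_one] with y hy
      simp [ξ, hy]
    · exact (contDiffAt_const.sub χ.contDiffAt).smul (hη.contDiffAt.comp x
        (((contDiffAt_norm ℝ hx).inv (norm_ne_zero_iff.2 hx)).smul contDiffAt_id))
  have hnorm (t r) (hr : ε ≤ r) : ‖r • k.toFun t‖ = r := by
    rw [norm_smul, k.norm_eq_one, mul_one, Real.norm_of_nonneg (hε.le.trans hr)]
  refine ⟨ξ, hξ, exists_bound_fderiv_of_homogeneous (hξ.of_le (by simp)) hε ?_, ?_, ?_⟩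
  · intro x c hx hc
    have hc0 : 0 < c := by linarith
    have hcx : ‖c • x‖ = c * ‖x‖ := by rw [norm_smul, Real.norm_of_nonneg hc0.le]
    rw [hξ1 x (by linarith), hξ1 (c • x) (by rw [hcx]; nlinarith), hcx, mul_inv, smul_smul,
      mul_right_comm, inv_mul_cancel₀ hc0.ne', one_mul]
  · intro t r hr
    rw [hξ1 _ (by rw [hnorm t r hr]; linarith), hnorm t r hr, inv_smul_smul₀ (by linarith),
      (hηk t).1]
  · intro t r hr
    have hr0 : 0 < r := by linarith
    have h1 : HasFDerivAt ξ (r⁻¹ • k.tangentJet t) (r • k.toFun t) := by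
      have e1 := HasFDerivAt.comp (g := η) (r • k.toFun t)
        (by rw [hnorm t r hr, inv_smul_smul₀ hr0.ne']; exact (hηk t).2)
        (hasFDerivAt_normalize (k.norm_eq_one t) hr0)
      have e2 : ξ =ᶠ[𝓝 (r • k.toFun t)] fun x => η (‖x‖⁻¹ • x) := by
        have : ∀ᶠ w : R4 in 𝓝 (r • k.toFun t), ε / 2 < ‖w‖ :=
          (continuous_norm.tendsto _).eventually (lt_mem_nhds (by rw [hnorm t r hr]; linarith))
        filter_upwards [this] with w hw
        exact hξ1 w hw.le
      refine (e1.congr_of_eventuallyEq e2).congr_fderiv ?_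
      ext v : 1
      simp [k.tangentJet_self]
    have h2 : curl ξ (r • k.toFun t) =
        r⁻¹ • (k.tangentJet t - (k.tangentJet t).adjoint) := by
      rw [curl, h1.fderiv, map_smulₛₗ, conj_trivial]
      exact (smul_sub _ _ _).symm
    rw [h2, norm_smul, Real.norm_of_nonneg (by positivity)]
    exact mul_le_of_le_one_right (by positivity) (k.norm_tangentJet_sub_adjoint_le t)

/-! ## The conifold transition of the perturbed conormal bundle -/

theorem mem_contraction_image_iff {k : Knot} {ε : ℝ} {z : C4} :
    z ∈ contraction '' perturbedConormal k ε ↔ ∃ t, rePart z = ‖imPart z‖ • k.toFun t ∧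
      inner ℝ (k.toFun t) (imPart z) = 0 ∧ inner ℝ (k.tangent t) (imPart z) = ε := by
  constructor
  · rintro ⟨_, ⟨t, p, h1, h2, rfl⟩, rfl⟩
    change inner ℝ p (k.tangent t) = 0 at h2
    refine ⟨t, ?_⟩
    change rePart (ofXP _ _) = ‖imPart (ofXP _ _)‖ • _ ∧ inner ℝ _ (imPart (ofXP _ _)) = 0 ∧
      inner ℝ _ (imPart (ofXP _ _)) = ε
    rw [rePart_ofXP, imPart_ofXP]
    change _ ∧ inner ℝ _ (p + ε • k.tangent t) = 0 ∧ inner ℝ _ (p + ε • k.tangent t) = ε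
    simp only [inner_add_right, inner_smul_right, k.inner_tangent, k.inner_tangent_self,
      real_inner_comm p, h1, h2]
    simp
  · rintro ⟨t, h1, h2, h3⟩
    refine ⟨(k.toFun t, imPart z), ⟨t, imPart z - ε • k.tangent t, ?_, ?_, ?_⟩, ?_⟩
    · rw [real_inner_comm, inner_sub_right, h2, inner_smul_right, k.inner_tangent]
      simp
    · change inner ℝ _ (k.tangent t) = 0
      rw [real_inner_comm, inner_sub_right, h3, inner_smul_right, k.inner_tangent_self]
      simp
    · change _ = (_, _ - ε • k.tangent t + ε • k.tangent t)
      rw [sub_add_cancel]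
    · change ofXP (‖imPart z‖ • k.toFun t) (imPart z) = z
      rw [← h1, ofXP_rePart_imPart]

/-- The image is the projection of a closed subset of ℂ⁴ × [0, length]; the projection is closed
because the parameter runs over one compact period. -/
theorem isClosed_contraction_image (k : Knot) (ε : ℝ) :
    IsClosed (contraction '' perturbedConormal k ε) := by
  let S : Set (C4 × Icc (0 : ℝ) (0 + k.length)) := {y | rePart y.1 = ‖imPart y.1‖ • k.toFun y.2 ∧
      inner ℝ (k.toFun y.2) (imPart y.1) = 0 ∧ inner ℝ (k.tangent y.2) (imPart y.1) = ε}
  have hre : Continuous rePart := reL.continuous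
  have him : Continuous imPart := imL.continuous
  have hk := k.smooth.continuous
  have hk' := k.contDiff_tangent.continuous
  have hS : IsClosed S := by
    refine IsClosed.inter (isClosed_eq (by fun_prop) (by fun_prop)) (IsClosed.inter ?_ ?_)
    · exact isClosed_eq (by fun_prop) (by fun_prop)
    · exact isClosed_eq (by fun_prop) (by fun_prop)
  convert isClosedMap_fst_of_compactSpace S hS
  ext z
  rw [mem_contraction_image_iff]
  constructor
  · rintro ⟨t, h⟩
    have ht := toIcoMod_mem_Ico k.length_pos 0 t
    refine ⟨(z, ⟨_, Ico_subset_Icc_self ht⟩), ?_, rfl⟩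
    change rePart z = ‖imPart z‖ • k.toFun (toIcoMod k.length_pos 0 t) ∧
      inner ℝ (k.toFun (toIcoMod k.length_pos 0 t)) (imPart z) = 0 ∧
      inner ℝ (k.tangent (toIcoMod k.length_pos 0 t)) (imPart z) = ε
    rwa [k.toIcoMod_eq, k.periodic.int_mul, k.periodic_tangent.int_mul]
  · rintro ⟨⟨_, t⟩, h, rfl⟩
    exact ⟨t, h⟩

theorem le_norm_of_inner_tangent {k : Knot} {ε t : ℝ} {p : R4}
    (h : inner ℝ (k.tangent t) p = ε) : ε ≤ ‖p‖ := by
  have := real_inner_le_norm (k.tangent t) p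
  rwa [h, k.norm_tangent, one_mul] at this

/-- The closure adds nothing and removing 0 removes nothing: $\langle\dot
k,p\rangle=\varepsilon\ne0$ on the image, which is closed. -/
theorem conifoldTransition_perturbedConormal (k : Knot) {ε : ℝ} (hε : 0 < ε) :
    conifoldTransition (perturbedConormal k ε) =
      ResolvedConifold.proj₂ ⁻¹' (contraction '' perturbedConormal k ε) := by
  have h : contraction '' perturbedConormal k ε \ {0} = contraction '' perturbedConormal k ε := by
    refine sdiff_singleton_eq_self fun h0 => ?_
    obtain ⟨t, -, -, h3⟩ := mem_contraction_image_iff.1 h0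
    rw [← imL_apply, map_zero, inner_zero_right] at h3
    exact hε.ne h3
  rw [conifoldTransition, h, IsClosed.closure_eq]
  exact (isClosed_contraction_image k ε).preimage ResolvedConifold.continuous_proj₂

theorem mem_conifoldTransition_iff {k : Knot} {ε : ℝ} (hε : 0 < ε) {q : ResolvedConifold} :
    q ∈ conifoldTransition (perturbedConormal k ε) ↔
      ∃ t, rePart q.proj₂ = ‖imPart q.proj₂‖ • k.toFun t ∧
      inner ℝ (k.toFun t) (imPart q.proj₂) = 0 ∧ inner ℝ (k.tangent t) (imPart q.proj₂) = ε := by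
  rw [conifoldTransition_perturbedConormal k hε, mem_preimage, mem_contraction_image_iff]

/-! ## Level sets of submersions -/

section Slice

variable {E : Type*} [NormedAddCommGroup E] [NormedSpace ℝ E]
variable {M : Type*} [TopologicalSpace M] [ChartedSpace E M] [IsManifold 𝓘(ℝ, E) ∞ M]

theorem trans_mem_maximalAtlas {e : OpenPartialHomeomorph M E}
    (he : e ∈ IsManifold.maximalAtlas 𝓘(ℝ, E) ∞ M) {h : OpenPartialHomeomorph E E}
    (hh : h ∈ contDiffGroupoid ∞ 𝓘(ℝ, E)) :
    e ≫ₕ h ∈ IsManifold.maximalAtlas 𝓘(ℝ, E) ∞ M := by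
  intro e' he'
  have he' := IsManifold.subset_maximalAtlas (I := 𝓘(ℝ, E)) (n := ∞) he'
  have h1 := IsManifold.compatible_of_mem_maximalAtlas he he'
  have h2 := IsManifold.compatible_of_mem_maximalAtlas he' he
  constructor
  · rw [OpenPartialHomeomorph.trans_symm_eq_symm_trans_symm, OpenPartialHomeomorph.trans_assoc]
    exact StructureGroupoid.trans _ (StructureGroupoid.symm _ hh) h1
  · rw [← OpenPartialHomeomorph.trans_assoc]
    exact StructureGroupoid.trans _ h2 hh

theorem mem_contDiffGroupoid_of_contDiffOn {h : OpenPartialHomeomorph E E}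
    (h1 : ContDiffOn ℝ ∞ h h.source) (h2 : ContDiffOn ℝ ∞ h.symm h.target) :
    h ∈ contDiffGroupoid ∞ 𝓘(ℝ, E) := by
  rw [contDiffGroupoid, mem_groupoid_of_pregroupoid]
  simpa [contDiffPregroupoid] using And.intro h1 h2

theorem exists_slice_chart [FiniteDimensional ℝ E] {F : Type*} [NormedAddCommGroup F]
    [NormedSpace ℝ F] [FiniteDimensional ℝ F] {L : Set M} {q : M}
    {e : OpenPartialHomeomorph M E} (he : e ∈ IsManifold.maximalAtlas 𝓘(ℝ, E) ∞ M)
    (hq : q ∈ e.source) {O : Set E} (hO : IsOpen O) (hqO : e q ∈ O) {G : E → F}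
    (hG : ContDiffOn ℝ ∞ G O) {G' : E →L[ℝ] F} (hG' : HasFDerivAt G G' (e q))
    (hsurj : Function.Surjective G') (hL : ∀ y ∈ e.target ∩ O, e.symm y ∈ L ↔ G y = 0) :
    ∃ e' ∈ IsManifold.maximalAtlas 𝓘(ℝ, E) ∞ M, q ∈ e'.source ∧
      ∃ V : Submodule ℝ E, Module.finrank ℝ V + Module.finrank ℝ F = Module.finrank ℝ E ∧
        e'.source ∩ L = e'.source ∩ e' ⁻¹' V := by
  obtain ⟨R', hR'⟩ := (G' : E →ₗ[ℝ] F).exists_rightInverse_of_surjective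
    (LinearMap.range_eq_top.2 hsurj)
  let R : F →L[ℝ] E := LinearMap.toContinuousLinearMap R'
  have hR (v : F) : G' (R v) = v := DFunLike.congr_fun hR' v
  -- `H` has derivative the identity at `e q` and satisfies `G' ∘ H = G`, so it straightens the zero
  -- set of `G` to the linear slice `ker G'`.
  let H : E → E := fun y => (y - e q) + R (G y - G' (y - e q))
  have hGH (y : E) : G' (H y) = G y := by simp [H, hR]
  have hH : ContDiffOn ℝ ∞ H O := (contDiffOn_id.sub contDiffOn_const).add
    (R.contDiff.comp_contDiffOn (hG.sub (G'.contDiff.comp_contDiffOn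
      (contDiffOn_id.sub contDiffOn_const))))
  have hH' : HasFDerivAt H ((ContinuousLinearEquiv.refl ℝ E : E ≃L[ℝ] E) : E →L[ℝ] E) (e q) := by
    have d1 : HasFDerivAt (fun y => y - e q) (ContinuousLinearMap.id ℝ E) (e q) :=
      (hasFDerivAt_id (e q)).sub_const _
    have d2 := G'.hasFDerivAt.comp (e q) d1
    refine (d1.add (R.hasFDerivAt.comp (e q) (hG'.sub d2))).congr_fderiv ?_
    ext v
    simp
  obtain ⟨h, hqh, hhO, hhH, hhs⟩ := exists_openPartialHomeomorph_of_contDiffOn hO hH hqO hH'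
  have hh1 : ContDiffOn ℝ ∞ h h.source := by
    rw [hhH]
    exact hH.mono hhO
  refine ⟨e ≫ₕ h, trans_mem_maximalAtlas he (mem_contDiffGroupoid_of_contDiffOn hh1 hhs), ?_,
    LinearMap.ker (G' : E →ₗ[ℝ] F), ?_, ?_⟩
  · rw [OpenPartialHomeomorph.trans_source]
    exact ⟨hq, hqh⟩
  · rw [add_comm, ← LinearMap.finrank_range_add_finrank_ker (G' : E →ₗ[ℝ] F),
      LinearMap.range_eq_top.2 hsurj, finrank_top]
  · ext x
    refine and_congr_right fun hx => ?_
    rw [OpenPartialHomeomorph.trans_source] at hx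
    have := hL (e x) ⟨e.map_source hx.1, hhO hx.2⟩
    rw [e.left_inv hx.1] at this
    rw [this, ← hGH, ← hhH]
    rfl

end Slice

/-! ### A homogeneous parameter near the cone over the knot, and normal spaces. -/

theorem Knot.exists_conic_parameter (k : Knot) (t₀ : ℝ) : ∃ W : Set R4, IsOpen W ∧
    ∃ σ : R4 → ℝ, ContDiffOn ℝ ∞ σ W ∧ (∀ r : ℝ, 0 < r → r • k.toFun t₀ ∈ W ∧
      σ (r • k.toFun t₀) = t₀) ∧
    (∀ (r t : ℝ), 0 < r → r • k.toFun t ∈ W → ∃ n : ℤ, σ (r • k.toFun t) = t + n * k.length) ∧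
    ∀ x ∈ W, x ≠ 0 ∧ 0 < inner ℝ (k.toFun t₀) x ∧ 0 < inner ℝ (k.toFun t₀) (k.toFun (σ x)) ∧
      ‖x‖ * inner ℝ (k.tangent t₀) (k.toFun (σ x)) = inner ℝ (k.tangent t₀) x := by
  obtain ⟨U, hU, hU0, τ, hτ, hτk, hτ0, hτU⟩ := k.exists_parameter t₀
  let V : Set R4 := (U ∩ (fun x => k.toFun (τ x)) ⁻¹' {y | 0 < inner ℝ (k.toFun t₀) y}) ∩
    {y | 0 < inner ℝ (k.toFun t₀) y}
  have hpos : IsOpen {y : R4 | 0 < inner ℝ (k.toFun t₀) y} :=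
    isOpen_lt continuous_const (by fun_prop)
  have hV : IsOpen V := ((k.smooth.continuous.comp_continuousOn
    hτ.continuousOn).isOpen_inter_preimage hU hpos).inter hpos
  have hN : ContDiffOn ℝ ∞ (fun x : R4 => ‖x‖⁻¹ • x) {0}ᶜ := fun x hx =>
    (((contDiffAt_norm ℝ hx).inv (norm_ne_zero_iff.2 hx)).smul contDiffAt_id).contDiffWithinAt
  have hNk (r t : ℝ) (hr : 0 < r) : ‖r • k.toFun t‖⁻¹ • r • k.toFun t = k.toFun t := by
    rw [norm_smul, k.norm_eq_one, mul_one, Real.norm_of_nonneg hr.le, inv_smul_smul₀ hr.ne']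
  refine ⟨{0}ᶜ ∩ (fun x : R4 => ‖x‖⁻¹ • x) ⁻¹' V,
    hN.continuousOn.isOpen_inter_preimage isOpen_compl_singleton hV,
    fun x => τ (‖x‖⁻¹ • x), ?_, fun r hr => ⟨⟨?_, ?_⟩, ?_⟩, ?_, ?_⟩
  · exact hτ.comp (hN.mono inter_subset_left) fun x hx => hx.2.1.1
  · intro h0
    rw [mem_singleton_iff, ← norm_eq_zero, norm_smul, k.norm_eq_one, mul_one, norm_eq_zero] at h0
    exact hr.ne' h0
  · rw [mem_preimage, hNk r t₀ hr]
    have h1 : (0 : ℝ) < inner ℝ (k.toFun t₀) (k.toFun t₀) := by rw [k.inner_self]; exact one_pos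
    refine ⟨⟨hU0, ?_⟩, h1⟩
    change 0 < inner ℝ (k.toFun t₀) (k.toFun (τ (k.toFun t₀)))
    rwa [hτ0]
  · simp only [hNk r t₀ hr, hτ0]
  · rintro r t hr ⟨-, ht⟩
    rw [mem_preimage, hNk r t hr] at ht
    simp only [hNk r t hr]
    exact hτk t ht.1.1
  · rintro x ⟨hx0, ⟨hx1, hx2⟩, hx3⟩
    have hx0' : 0 < ‖x‖ := norm_pos_iff.2 hx0
    refine ⟨hx0, ?_, hx2, ?_⟩
    · change 0 < inner ℝ (k.toFun t₀) (‖x‖⁻¹ • x) at hx3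
      rw [inner_smul_right] at hx3
      exact pos_of_mul_pos_right hx3 (by positivity)
    · rw [hτU _ hx1, inner_smul_right, mul_inv_cancel_left₀ hx0'.ne']

/-- The orthogonal complement of the plane spanned by the point `k t` of a knot and its tangent. -/
def Knot.normalSpace (k : Knot) (t : ℝ) : Submodule ℝ R4 :=
  (Submodule.span ℝ {k.toFun t, k.tangent t})ᗮ

theorem Knot.mem_normalSpace_iff {k : Knot} {t : ℝ} {v : R4} :
    v ∈ k.normalSpace t ↔ inner ℝ (k.toFun t) v = 0 ∧ inner ℝ (k.tangent t) v = 0 := by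
  rw [Knot.normalSpace, Submodule.mem_orthogonal]
  refine ⟨fun h => ⟨h _ (Submodule.subset_span (by simp)), h _ (Submodule.subset_span (by simp))⟩,
    fun ⟨h1, h2⟩ u hu => ?_⟩
  obtain ⟨a, b, rfl⟩ := Submodule.mem_span_pair.1 hu
  rw [inner_add_left, inner_smul_left, inner_smul_left, h1, h2, mul_zero, mul_zero, add_zero]

theorem Knot.finrank_normalSpace (k : Knot) (t : ℝ) : Module.finrank ℝ (k.normalSpace t) = 2 := by
  have h := (Submodule.span ℝ {k.toFun t, k.tangent t}).finrank_add_finrank_orthogonal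
  have hli : LinearIndependent ℝ ![k.toFun t, k.tangent t] := by
    refine Orthonormal.linearIndependent (𝕜 := ℝ) ⟨fun i => ?_, fun i j hij => ?_⟩
    · fin_cases i
      · exact k.norm_eq_one t
      · exact k.norm_tangent t
    · fin_cases i <;> fin_cases j
      · exact absurd rfl hij
      · exact k.inner_tangent t
      · exact (real_inner_comm _ _).trans (k.inner_tangent t)
      · exact absurd rfl hij
  have h2 := finrank_span_eq_card hli
  rw [Matrix.range_cons, Matrix.range_cons, Matrix.range_empty, union_empty,
    singleton_union] at h2
  rw [h2, finrank_euclideanSpace] at h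
  simp only [Fintype.card_fin] at h
  change 2 + Module.finrank ℝ (k.normalSpace t) = 4 at h
  omega

/-- Orthogonal projection to the normal space. -/
def Knot.normalProj (k : Knot) (t : ℝ) : R4 →L[ℝ] k.normalSpace t :=
  (k.normalSpace t).orthogonalProjectionOnto

theorem Knot.normalProj_of_mem (k : Knot) (t : ℝ) (v : k.normalSpace t) :
    k.normalProj t v = v :=
  Submodule.orthogonalProjectionOnto_mem_subspace_eq_self v

theorem Knot.normalProj_eq_zero_iff {k : Knot} {t : ℝ} {v : R4} :
    k.normalProj t v = 0 ↔ ∃ a b : ℝ, v = a • k.toFun t + b • k.tangent t := by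
  rw [Knot.normalProj, Submodule.orthogonalProjectionOnto_eq_zero_iff, Knot.normalSpace,
    Submodule.orthogonal_orthogonal, Submodule.mem_span_pair]
  simp only [eq_comm]

/-- The difference lies in the plane of $k,\dot k$ and has no $\dot k$ component. Two points of
equal norm on a line parallel to $k$ agree up to the sign of their $k$ component, which positivity
fixes. -/
theorem Knot.eq_of_normalProj_eq_zero {k : Knot} {t₀ : ℝ} {x y : R4} (hxy : ‖x‖ = ‖y‖)
    (hx : 0 < inner ℝ (k.toFun t₀) x) (hy : 0 < inner ℝ (k.toFun t₀) y)
    (h : inner ℝ (k.tangent t₀) x = inner ℝ (k.tangent t₀) y)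
    (h0 : k.normalProj t₀ (x - y) = 0) : x = y := by
  obtain ⟨a, b, hab⟩ := Knot.normalProj_eq_zero_iff.1 h0
  have hb : b = 0 := by
    have := congrArg (fun v => inner ℝ (k.tangent t₀) v) hab
    simp only [inner_sub_right, inner_add_right, inner_smul_right, h, sub_self,
      real_inner_comm (k.toFun t₀) (k.tangent t₀), k.inner_tangent, k.inner_tangent_self] at this
    linarith
  rw [hb, zero_smul, add_zero, sub_eq_iff_eq_add] at hab
  have h1 : ‖x‖ ^ 2 = a ^ 2 + 2 * a * inner ℝ (k.toFun t₀) y + ‖y‖ ^ 2 := by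
    rw [hab, norm_add_sq_real, norm_smul, k.norm_eq_one, inner_smul_left, mul_one,
      Real.norm_eq_abs, sq_abs]
    simp
    ring
  have h2 : inner ℝ (k.toFun t₀) x = a + inner ℝ (k.toFun t₀) y := by
    rw [hab, inner_add_right, inner_smul_right, k.inner_self, mul_one]
  rw [hxy] at h1
  have h3 : a * (a + 2 * inner ℝ (k.toFun t₀) y) = 0 := by linarith
  rcases mul_eq_zero.1 h3 with ha | ha
  · rw [hab, ha, zero_smul, zero_add]
  · exfalso
    linarith

/-! ## The tangent spaces of the conifold -/

namespace ResolvedConifold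

theorem sum_sq_bundleVec (i : Fin 2) (y : ℂ × ℂ × ℂ) : ∑ j, bundleVec i y j ^ 2 = 0 := by
  have h : ∀ z : C4, ∑ j, z j ^ 2 = wCoord z 0 * wCoord z 3 - wCoord z 1 * wCoord z 2 := by
    intro z
    simp only [Fin.sum_univ_four, wCoord]
    simp
    linear_combination (z 1 ^ 2 + z 3 ^ 2) * I_sq
  rw [h, bundleVec, wCoord_ofW]
  simp
  ring

theorem norm_rePart_eq_norm_imPart_of_sum_sq {z : C4} (h : ∑ j, z j ^ 2 = 0) :
    ‖rePart z‖ = ‖imPart z‖ ∧ inner ℝ (rePart z) (imPart z) = 0 := by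
  have h1 := congrArg Complex.re h
  have h2 := congrArg Complex.im h
  simp only [Fin.sum_univ_four, pow_two, Complex.add_re, Complex.add_im, Complex.mul_re,
    Complex.mul_im, Complex.zero_re, Complex.zero_im] at h1 h2
  constructor
  · rw [← sq_eq_sq₀ (norm_nonneg _) (norm_nonneg _), EuclideanSpace.norm_sq_eq,
      EuclideanSpace.norm_sq_eq]
    simp [Fin.sum_univ_four, rePart, imPart]
    linarith
  · rw [PiLp.inner_apply]
    simp [Fin.sum_univ_four, rePart, imPart]
    linarith

/-- Away from the zero section the differential of `π₂` is onto the tangent space of the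
conifold. -/
theorem exists_fderiv_bundleVec_eq {i : Fin 2} {y : ℂ × ℂ × ℂ} (hy : bundleVec i y ≠ 0) {Z : C4}
    (hZ : ∑ j, bundleVec i y j * Z j = 0) : ∃ X, fderiv ℝ (bundleVec i) y X = Z := by
  have hd : DifferentiableAt ℂ (bundleVec i) y := (contDiff_bundleVec i).differentiable (by simp) y
  have hreal : fderiv ℝ (bundleVec i) y = (fderiv ℂ (bundleVec i) y).restrictScalars ℝ :=
    hd.fderiv_restrictScalars ℝ
  let B : (ℂ × ℂ × ℂ) →ₗ[ℂ] C4 := fderiv ℂ (bundleVec i) y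
  let φ : C4 →ₗ[ℂ] ℂ := ∑ j, bundleVec i y j • (EuclideanSpace.proj j : C4 →L[ℂ] ℂ).toLinearMap
  have hφ (X : C4) : φ X = ∑ j, bundleVec i y j * X j := by simp [φ]
  have hBinj : Function.Injective B := by
    rw [← LinearMap.ker_eq_bot, LinearMap.ker_eq_bot']
    intro X hX
    have hX' : fderiv ℝ (bundleVec i) y X = 0 := by rw [hreal]; exact hX
    obtain ⟨h1, h2, h3, h4⟩ := wCoord_fderiv_bundleVec i y X
    rw [hX', ← wCoordL_apply, map_zero] at h1 h2 h3 h4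
    rw [← h1] at h2
    rw [← h3] at h4
    refine Prod.ext ?_ (Prod.ext h1.symm h3.symm)
    by_contra hX1
    have e1 : y.2.1 = 0 := by simpa [show X.1 ≠ 0 from hX1] using h2.symm
    have e2 : y.2.2 = 0 := by simpa [show X.1 ≠ 0 from hX1] using h4.symm
    apply hy
    rw [bundleVec, e1, e2]
    ext j
    fin_cases j <;> simp [ofW]
  have hle : LinearMap.range B ≤ LinearMap.ker φ := by
    rintro _ ⟨X, rfl⟩
    have h1 : HasFDerivAt (fun y => ∑ j, bundleVec i y j ^ 2)
        (∑ j, (2 * bundleVec i y j) •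
          ((EuclideanSpace.proj j : C4 →L[ℂ] ℂ) ∘L fderiv ℂ (bundleVec i) y)) y := by
      refine HasFDerivAt.fun_sum fun j _ => ?_
      have := ((EuclideanSpace.proj j : C4 →L[ℂ] ℂ).hasFDerivAt.comp y hd.hasFDerivAt).pow 2
      simpa using this
    simp only [sum_sq_bundleVec] at h1
    have h2 := DFunLike.congr_fun (h1.unique (hasFDerivAt_const 0 y)) X
    rw [LinearMap.mem_ker, hφ]
    simp [mul_assoc, ← Finset.mul_sum] at h2
    exact h2
  have hφ0 : φ ≠ 0 := by
    intro h
    apply hy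
    ext j
    have := DFunLike.congr_fun h (EuclideanSpace.single j (1 : ℂ))
    rw [hφ] at this
    simpa using this
  -- Both spaces have complex dimension 3: the source of an injective map, and a hyperplane in ℂ⁴.
  -- The inclusion is therefore an equality.
  have hfin : Module.finrank ℂ (LinearMap.range B) = Module.finrank ℂ (LinearMap.ker φ) := by
    have e1 := Module.Dual.finrank_ker_add_one_of_ne_zero hφ0
    rw [LinearMap.finrank_range_of_inj hBinj]
    simp at e1 ⊢
    omega
  have hZ' : Z ∈ LinearMap.range B := by
    rw [Submodule.eq_of_le_of_finrank_eq hle hfin, LinearMap.mem_ker, hφ, hZ]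
  obtain ⟨X, hX⟩ := hZ'
  exact ⟨X, by rw [hreal]; exact hX⟩

theorem sum_mul_ofXP (z : C4) (a b : R4) : ∑ j, z j * ofXP a b j =
    ((inner ℝ (rePart z) a - inner ℝ (imPart z) b : ℝ) : ℂ) +
      ((inner ℝ (rePart z) b + inner ℝ (imPart z) a : ℝ) : ℂ) * I := by
  rw [PiLp.inner_apply, PiLp.inner_apply, PiLp.inner_apply, PiLp.inner_apply]
  apply Complex.ext <;> simp [Fin.sum_univ_four, rePart, imPart, ofXP] <;> ring

end ResolvedConifold

/-! ### The transition as a regular level set. -/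

/-- Local equations of the image in the conifold of the perturbed conormal bundle. -/
def Knot.equation (k : Knot) (ε t₀ : ℝ) (σ : R4 → ℝ) (z : C4) : k.normalSpace t₀ × ℝ :=
  (k.normalProj t₀ (rePart z - ‖rePart z‖ • k.toFun (σ (rePart z))),
    inner ℝ (k.tangent (σ (rePart z))) (imPart z) - ε)

theorem Knot.contDiffOn_equation (k : Knot) (ε t₀ : ℝ) {σ : R4 → ℝ} {W : Set R4}
    (hσ : ContDiffOn ℝ ∞ σ W) (hW : ∀ x ∈ W, x ≠ 0) :
    ContDiffOn ℝ ∞ (k.equation ε t₀ σ) (rePart ⁻¹' W) := by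
  have hre : ContDiffOn ℝ ∞ rePart (rePart ⁻¹' W) := reL.contDiff.contDiffOn
  have him : ContDiffOn ℝ ∞ imPart (rePart ⁻¹' W) := imL.contDiff.contDiffOn
  have hσ' : ContDiffOn ℝ ∞ (fun z => σ (rePart z)) (rePart ⁻¹' W) := hσ.comp hre fun z hz => hz
  refine ContDiffOn.prodMk ?_ ?_
  · exact (k.normalProj t₀).contDiff.comp_contDiffOn
      (hre.sub ((hre.norm ℝ fun z hz => hW _ hz).smul (k.smooth.comp_contDiffOn hσ')))
  · exact ((k.contDiff_tangent.comp_contDiffOn hσ').inner ℝ him).sub contDiffOn_const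

theorem hasFDerivAt_conic_parameter_radial {σ : R4 → ℝ} {W : Set R4} (hWo : IsOpen W)
    (hσ : ContDiffOn ℝ ∞ σ W) {u : R4} {t₀ : ℝ} (h : ∀ r : ℝ, 0 < r → r • u ∈ W ∧ σ (r • u) = t₀)
    {r : ℝ} (hr : 0 < r) : fderiv ℝ σ (r • u) u = 0 := by
  have h1 : HasFDerivAt σ (fderiv ℝ σ (r • u)) (r • u) :=
    ((hσ.contDiffAt (hWo.mem_nhds (h r hr).1)).differentiableAt (by simp)).hasFDerivAt
  have h2 : HasDerivAt (fun s : ℝ => s • u) u r := by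
    simpa using (hasDerivAt_id r).smul_const u
  have h3 := h1.comp_hasDerivAt r h2
  have h4 : HasDerivAt (σ ∘ fun s : ℝ => s • u) 0 r := by
    refine (hasDerivAt_const r t₀).congr_of_eventuallyEq ?_
    filter_upwards [lt_mem_nhds hr] with s hs
    exact (h s hs).2
  exact h3.unique h4

/-- The derivatives of $|x|$ and of $k(\sigma(x))$ contribute only multiples of $k(t_0)$ and $\dot
k(t_0)$, which the normal projection kills. -/
theorem Knot.hasFDerivAt_equation (k : Knot) (ε t₀ : ℝ) {σ : R4 → ℝ} {W : Set R4} (hWo : IsOpen W)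
    (hσ : ContDiffOn ℝ ∞ σ W)
    (h : ∀ r : ℝ, 0 < r → r • k.toFun t₀ ∈ W ∧ σ (r • k.toFun t₀) = t₀) {z : C4}
    {r : ℝ} (hr : 0 < r) (hz : rePart z = r • k.toFun t₀) :
    ∃ T : C4 →L[ℝ] k.normalSpace t₀ × ℝ, HasFDerivAt (k.equation ε t₀ σ) T z ∧
      ∀ Z, T Z = (k.normalProj t₀ (rePart Z),
        fderiv ℝ σ (rePart z) (rePart Z) * inner ℝ (k.accel t₀) (imPart z) +
          inner ℝ (k.tangent t₀) (imPart Z)) := by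
  have hzW : rePart z ∈ W := hz ▸ (h r hr).1
  have hz0 : rePart z ≠ 0 := by
    intro h0
    rw [h0, eq_comm, smul_eq_zero, or_iff_right hr.ne', ← norm_eq_zero, k.norm_eq_one] at hz
    exact one_ne_zero hz
  have hσz : σ (rePart z) = t₀ := hz ▸ (h r hr).2
  have dre : HasFDerivAt rePart reL z := reL.hasFDerivAt
  have dim : HasFDerivAt imPart imL z := imL.hasFDerivAt
  have dσ : HasFDerivAt (fun z => σ (rePart z)) (fderiv ℝ σ (rePart z) ∘L reL) z :=
    ((hσ.contDiffAt (hWo.mem_nhds hzW)).differentiableAt (by simp)).hasFDerivAt.comp z dre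
  have dn : HasFDerivAt (fun z => ‖rePart z‖) (fderiv ℝ norm (rePart z) ∘L reL) z :=
    ((contDiffAt_norm (n := 1) ℝ hz0).differentiableAt (by simp)).hasFDerivAt.comp z dre
  have dk := (k.hasDerivAt (σ (rePart z))).hasFDerivAt.comp z dσ
  have dk' := (k.hasDerivAt_tangent (σ (rePart z))).hasFDerivAt.comp z dσ
  have d1 := (k.normalProj t₀).hasFDerivAt.comp z (dre.sub (dn.smul dk))
  have d2 := (dk'.inner ℝ dim).sub_const ε
  refine ⟨_, d1.prodMk d2, fun Z => Prod.ext ?_ ?_⟩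
  · have e1 : k.normalProj t₀ (k.toFun t₀) = 0 :=
      Knot.normalProj_eq_zero_iff.2 ⟨1, 0, by simp⟩
    have e2 : k.normalProj t₀ (k.tangent t₀) = 0 :=
      Knot.normalProj_eq_zero_iff.2 ⟨0, 1, by simp⟩
    simp [hσz, e1, e2]
  · simp [hσz, inner_smul_left, add_comm]

theorem Knot.surjective_equation (k : Knot) {ε t₀ : ℝ} (hε : 0 < ε) {σ : R4 → ℝ} {W : Set R4}
    (hWo : IsOpen W) (hσ : ContDiffOn ℝ ∞ σ W)
    (h : ∀ r : ℝ, 0 < r → r • k.toFun t₀ ∈ W ∧ σ (r • k.toFun t₀) = t₀) {i : Fin 2}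
    {y : ℂ × ℂ × ℂ} {r : ℝ} (hr : 0 < r) (hz : rePart (bundleVec i y) = r • k.toFun t₀)
    (hz1 : inner ℝ (k.toFun t₀) (imPart (bundleVec i y)) = 0)
    (hz2 : inner ℝ (k.tangent t₀) (imPart (bundleVec i y)) = ε) :
    ∃ T : (ℂ × ℂ × ℂ) →L[ℝ] k.normalSpace t₀ × ℝ,
      HasFDerivAt (k.equation ε t₀ σ ∘ bundleVec i) T y ∧ Function.Surjective T := by
  obtain ⟨T, hT, hTZ⟩ := k.hasFDerivAt_equation ε t₀ hWo hσ h hr hz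
  refine ⟨T ∘L fderiv ℝ (bundleVec i) y, hT.comp y (hasFDerivAt_bundleVec i y), ?_⟩
  have hz0 : bundleVec i y ≠ 0 := by
    intro h0
    rw [h0, ← imL_apply, map_zero, inner_zero_right] at hz2
    exact hε.ne hz2
  have hrad := hasFDerivAt_conic_parameter_radial hWo hσ h hr
  rw [← hz] at hrad
  -- Moving $p$ along $\dot k$ changes the last equation at unit rate. The radial correction
  -- $(\varepsilon/r)k$ of $x$ makes the vector tangent to the conifold and is invisible to the
  -- equations, since σ is constant on rays.
  obtain ⟨X₂, hX₂⟩ := exists_fderiv_bundleVec_eq hz0 (Z := ofXP ((ε / r) • k.toFun t₀)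
    (k.tangent t₀)) (by
      rw [sum_mul_ofXP, hz, real_inner_comm (k.tangent t₀)]
      simp only [inner_smul_left, inner_smul_right, k.inner_self, k.inner_tangent, hz2,
        real_inner_comm (k.toFun t₀) (imPart _), hz1]
      simp [hr.ne'])
  have hT₂ : T (fderiv ℝ (bundleVec i) y X₂) = (0, 1) := by
    rw [hX₂, hTZ, rePart_ofXP, imPart_ofXP, map_smul, map_smul, hrad, k.inner_tangent_self,
      Knot.normalProj_eq_zero_iff.2 ⟨1, 0, by simp⟩]
    simp
  rintro ⟨v, c⟩
  obtain ⟨hv1, hv2⟩ := Knot.mem_normalSpace_iff.1 v.2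
  -- Moving $x$ by a normal vector $v$, with $p$ corrected along $k$ to preserve $\langle
  -- x,p\rangle=0$. Its effect on the last equation is then compensated by a multiple of `X₂`.
  obtain ⟨X₁, hX₁⟩ := exists_fderiv_bundleVec_eq hz0 (Z := ofXP v
    (-((inner ℝ (imPart (bundleVec i y)) (v : R4)) / r) • k.toFun t₀)) (by
      rw [sum_mul_ofXP, hz]
      simp only [inner_smul_left, inner_smul_right, k.inner_self, hv1,
        real_inner_comm (k.toFun t₀) (imPart _), hz1]
      simp [hr.ne'])
  have hT₁ : (T (fderiv ℝ (bundleVec i) y X₁)).1 = v := by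
    rw [hX₁, hTZ, rePart_ofXP, k.normalProj_of_mem]
  refine ⟨X₁ + (c - (T (fderiv ℝ (bundleVec i) y X₁)).2) • X₂, ?_⟩
  rw [ContinuousLinearMap.comp_apply, map_add, map_smul, map_add, map_smul, hT₂]
  refine Prod.ext ?_ ?_
  · simp [hT₁]
  · simp

theorem isEmbeddedSubmanifold_conifoldTransition (k : Knot) {ε : ℝ} (hε : 0 < ε) :
    IsEmbeddedSubmanifold (ℂ × ℂ × ℂ) 3 (conifoldTransition (perturbedConormal k ε)) := by
  intro q hq
  obtain ⟨t₀, h1, h2, h3⟩ := (mem_conifoldTransition_iff hε).1 hq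
  have hr : 0 < ‖imPart q.proj₂‖ := hε.trans_le (le_norm_of_inner_tangent h3)
  obtain ⟨W, hWo, σ, hσ, hσ0, hσk, hσW⟩ := k.exists_conic_parameter t₀
  set i := q.proj₁.index
  have hqi : q ∈ (chart i).source := q.proj₁.hom_index_ne_zero
  have hqb := proj₂_eq_bundleVec hqi
  rw [hqb] at h1 h2 h3 hr
  obtain ⟨T, hT, hTs⟩ := k.surjective_equation hε hWo hσ hσ0 hr h1 h2 h3
  have hcont : Continuous fun y => rePart (bundleVec i y) :=
    reL.continuous.comp (contDiff_bundleVec i).continuous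
  have hlocal : ∀ y ∈ (chart i).target ∩ (fun y => rePart (bundleVec i y)) ⁻¹' W,
      (chart i).symm y ∈ conifoldTransition (perturbedConormal k ε) ↔
        (k.equation ε t₀ σ ∘ bundleVec i) y = 0 := by
    rintro y ⟨-, hy⟩
    change rePart (bundleVec i y) ∈ W at hy
    rw [mem_conifoldTransition_iff hε, proj₂_chart_symm]
    obtain ⟨hn, hin⟩ := norm_rePart_eq_norm_imPart_of_sum_sq (sum_sq_bundleVec i y)
    obtain ⟨w1, w2, w3, w4⟩ := hσW _ hy
    constructor
    · rintro ⟨t, h1, h2, h3⟩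
      have hr : 0 < ‖imPart (bundleVec i y)‖ := hε.trans_le (le_norm_of_inner_tangent h3)
      have hy' : ‖imPart (bundleVec i y)‖ • k.toFun t ∈ W := h1 ▸ hy
      obtain ⟨n, hnt⟩ := hσk _ t hr hy'
      rw [← h1] at hnt
      change k.equation ε t₀ σ (bundleVec i y) = 0
      rw [Knot.equation, hnt, k.periodic.int_mul, k.periodic_tangent.int_mul, h3, hn, ← h1]
      simp
    · intro h0
      change k.equation ε t₀ σ (bundleVec i y) = 0 at h0
      obtain ⟨h4, h5⟩ := Prod.ext_iff.1 h0
      have hpos : 0 < ‖rePart (bundleVec i y)‖ := norm_pos_iff.2 w1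
      have h6 := Knot.eq_of_normalProj_eq_zero
        (y := ‖rePart (bundleVec i y)‖ • k.toFun (σ (rePart (bundleVec i y))))
        (by rw [norm_smul, k.norm_eq_one, mul_one, norm_norm]) w2
        (by rw [inner_smul_right]; positivity) (by rw [inner_smul_right, w4]) h4
      -- The condition $\langle k,p\rangle=0$ is not among the equations: it follows from $\langle
      -- x,p\rangle=0$ on the conifold once $x=|x|\,k$.
      refine ⟨σ (rePart (bundleVec i y)), hn ▸ h6, ?_, sub_eq_zero.1 h5⟩
      rw [h6, inner_smul_left] at hin
      simpa [hpos.ne'] using hin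
  obtain ⟨e', he', hqe', V, hV, hVL⟩ := exists_slice_chart
    (L := conifoldTransition (perturbedConormal k ε)) (chart_mem_maximalAtlas i) hqi
    (O := (fun y => rePart (bundleVec i y)) ⁻¹' W) (hWo.preimage hcont)
    (by rw [mem_preimage, h1]; exact (hσ0 _ hr).1)
    ((k.contDiffOn_equation ε t₀ hσ fun x hx => (hσW x hx).1).comp
      (contDiff_bundleVec_real i).contDiffOn fun y hy => hy) hT hTs hlocal
  refine ⟨e', he', hqe', V, ?_, hVL⟩
  have e1 : Module.finrank ℝ (ℂ × ℂ × ℂ) = 6 := by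
    simp [Module.finrank_prod, Complex.finrank_real_complex]
  have e2 : Module.finrank ℝ (k.normalSpace t₀ × ℝ) = 3 := by
    rw [Module.finrank_prod, k.finrank_normalSpace, Module.finrank_self]
  omega

/-! ## Tangent vectors -/

/-- Along a curve in the image, $x=|p|\,k(\sigma)$, $\langle k(\sigma),p\rangle=0$, $\langle\dot
k(\sigma),p\rangle=\varepsilon$ and $\xi(x)=\dot k(\sigma)$. Differentiating gives the four
relations, with $a$ and $T$ the velocities of $|p|$ and of σ. The values of ξ on the rays thus
determine its derivative on all tangential directions. -/
theorem velocity_contraction_image {k : Knot} {ε : ℝ} (hε : 0 < ε) {ξ : R4 → R4}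
    (hξ : ContDiff ℝ ∞ ξ) (hξk : ∀ t r : ℝ, ε ≤ r → ξ (r • k.toFun t) = k.tangent t) {t₀ : ℝ}
    {z : ℝ → C4} {Z : C4} (hz : HasDerivAt z Z 0)
    (hzL : ∀ᶠ s in 𝓝 0, z s ∈ contraction '' perturbedConormal k ε)
    (h1 : rePart (z 0) = ‖imPart (z 0)‖ • k.toFun t₀)
    (h3 : inner ℝ (k.tangent t₀) (imPart (z 0)) = ε) :
    ∃ a T : ℝ, rePart Z = a • k.toFun t₀ + (‖imPart (z 0)‖ * T) • k.tangent t₀ ∧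
      inner ℝ (k.toFun t₀) (imPart Z) = -ε * T ∧
      inner ℝ (k.tangent t₀) (imPart Z) = -(T * inner ℝ (k.accel t₀) (imPart (z 0))) ∧
      fderiv ℝ ξ (rePart (z 0)) (rePart Z) = T • k.accel t₀ := by
  have hr : 0 < ‖imPart (z 0)‖ := hε.trans_le (le_norm_of_inner_tangent h3)
  obtain ⟨W, hWo, σ, hσ, hσ0, hσk, hσW⟩ := k.exists_conic_parameter t₀
  have hzW : rePart (z 0) ∈ W := h1 ▸ (hσ0 _ hr).1
  have hσz : σ (rePart (z 0)) = t₀ := h1 ▸ (hσ0 _ hr).2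
  have dre : HasDerivAt (fun s => rePart (z s)) (rePart Z) 0 := reL.hasFDerivAt.comp_hasDerivAt 0 hz
  have dim : HasDerivAt (fun s => imPart (z s)) (imPart Z) 0 := imL.hasFDerivAt.comp_hasDerivAt 0 hz
  have dσ : HasDerivAt (fun s => σ (rePart (z s))) (fderiv ℝ σ (rePart (z 0)) (rePart Z)) 0 :=
    ((hσ.contDiffAt (hWo.mem_nhds hzW)).differentiableAt (by simp)).hasFDerivAt.comp_hasDerivAt 0 dre
  set T := fderiv ℝ σ (rePart (z 0)) (rePart Z) with hT
  have hn0 : imPart (z 0) ≠ 0 := norm_pos_iff.1 hr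
  have dn : HasDerivAt (fun s => ‖imPart (z s)‖) (fderiv ℝ norm (imPart (z 0)) (imPart Z)) 0 :=
    ((contDiffAt_norm (n := 1) ℝ hn0).differentiableAt (by simp)).hasFDerivAt.comp_hasDerivAt 0 dim
  set a := fderiv ℝ norm (imPart (z 0)) (imPart Z)
  have dk : HasDerivAt (fun s => k.toFun (σ (rePart (z s)))) (T • k.tangent t₀) 0 := by
    have := (k.hasDerivAt (σ (rePart (z 0)))).scomp 0 dσ
    rwa [hσz] at this
  have dk' : HasDerivAt (fun s => k.tangent (σ (rePart (z s)))) (T • k.accel t₀) 0 := by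
    have := (k.hasDerivAt_tangent (σ (rePart (z 0)))).scomp 0 dσ
    rwa [hσz] at this
  have hev : ∀ᶠ s in 𝓝 (0 : ℝ), rePart (z s) = ‖imPart (z s)‖ • k.toFun (σ (rePart (z s))) ∧
      inner ℝ (k.toFun (σ (rePart (z s)))) (imPart (z s)) = 0 ∧
      inner ℝ (k.tangent (σ (rePart (z s)))) (imPart (z s)) = ε ∧
      ξ (rePart (z s)) = k.tangent (σ (rePart (z s))) := by
    filter_upwards [hzL, dre.continuousAt.eventually (hWo.mem_nhds hzW)] with s hs hsW
    obtain ⟨t, e1, e2, e3⟩ := mem_contraction_image_iff.1 hs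
    have hεr := le_norm_of_inner_tangent e3
    obtain ⟨n, hn⟩ := hσk _ t (hε.trans_le hεr) (e1 ▸ hsW)
    rw [← e1] at hn
    rw [hn, k.periodic.int_mul, k.periodic_tangent.int_mul]
    exact ⟨e1, e2, e3, by rw [e1]; exact hξk t _ hεr⟩
  refine ⟨a, T, ?_, ?_, ?_, ?_⟩
  · have h := dn.smul dk
    rw [hσz] at h
    rw [dre.unique (h.congr_of_eventuallyEq (hev.mono fun s hs => hs.1)), smul_smul, add_comm]
  · have h := dk.inner ℝ dim
    have h' := h.unique ((hasDerivAt_const 0 0).congr_of_eventuallyEq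
      (hev.mono fun s hs => hs.2.1))
    rw [hσz, inner_smul_left, h3] at h'
    simp at h'
    linarith
  · have h := dk'.inner ℝ dim
    have h' := h.unique ((hasDerivAt_const 0 ε).congr_of_eventuallyEq
      (hev.mono fun s hs => hs.2.2.1))
    rw [hσz, inner_smul_left] at h'
    simp at h'
    linarith
  · have h : HasDerivAt (fun s => ξ (rePart (z s))) (fderiv ℝ ξ (rePart (z 0)) (rePart Z)) 0 :=
      (hξ.differentiable (by simp) _).hasFDerivAt.comp_hasDerivAt 0 dre
    exact h.unique (dk'.congr_of_eventuallyEq (hev.mono fun s hs => hs.2.2.2))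

theorem exists_hasDerivAt_of_mem_tangentVectors {L : Set ResolvedConifold} {q : ResolvedConifold}
    {X : TangentSpace 𝓘(ℝ, ℂ × ℂ × ℂ) q} (hX : X ∈ tangentVectors (ℂ × ℂ × ℂ) L q) :
    ∃ z : ℝ → C4, z 0 = q.proj₂ ∧ (∀ᶠ s in 𝓝 0, z s ∈ proj₂ '' L) ∧
      HasDerivAt z (mfderiv 𝓘(ℝ, ℂ × ℂ × ℂ) 𝓘(ℝ, C4) proj₂ q X) 0 := by
  obtain ⟨γ, rfl, hγ, hL, rfl⟩ := hX
  refine ⟨proj₂ ∘ γ, rfl, hL.mono fun s hs => ⟨_, hs, rfl⟩, ?_⟩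
  have h1 : HasMFDerivAt 𝓘(ℝ, ℝ) 𝓘(ℝ, C4) (proj₂ ∘ γ) 0 _ :=
    ((contMDiff_proj₂ (γ 0)).mdifferentiableAt (by simp)).hasMFDerivAt.comp 0
      (hγ.mdifferentiableAt (by simp)).hasMFDerivAt
  have h2 (T : ℝ →L[ℝ] C4) (h : HasFDerivAt (proj₂ ∘ γ) T 0) : HasDerivAt (proj₂ ∘ γ) (T 1) 0 :=
    h.hasDerivAt
  exact h2 _ h1.hasFDerivAt

/-- Let $(a,T)$ and $(b,S)$ be the parameters of the two velocities. The product $TS$ enters only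
symmetrically. The terms $-\varepsilon aS$ from $\langle k,\mathrm{Im}\rangle$ and $+\varepsilon aS$
from the shear cancel because $\langle k,\ddot k\rangle=-1$, and likewise for $bT$. -/
theorem perturbedForm_eq_zero_of_mem_tangentVectors {k : Knot} {ε : ℝ} (hε : 0 < ε) {ξ : R4 → R4}
    (hξ : ContDiff ℝ ∞ ξ) (hξk : ∀ t r : ℝ, ε ≤ r → ξ (r • k.toFun t) = k.tangent t)
    {q : ResolvedConifold} (hq : q ∈ conifoldTransition (perturbedConormal k ε))
    {X Y : TangentSpace 𝓘(ℝ, ℂ × ℂ × ℂ) q}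
    (hX : X ∈ tangentVectors (ℂ × ℂ × ℂ) (conifoldTransition (perturbedConormal k ε)) q)
    (hY : Y ∈ tangentVectors (ℂ × ℂ × ℂ) (conifoldTransition (perturbedConormal k ε)) q) :
    perturbedForm ξ ε q ![X, Y] = 0 := by
  obtain ⟨t₀, h1, h2, h3⟩ := (mem_conifoldTransition_iff hε).1 hq
  have himage : proj₂ '' conifoldTransition (perturbedConormal k ε) ⊆
      contraction '' perturbedConormal k ε := by
    rw [conifoldTransition_perturbedConormal k hε]
    exact image_preimage_subset _ _
  have key {X : TangentSpace 𝓘(ℝ, ℂ × ℂ × ℂ) q}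
      (hX : X ∈ tangentVectors (ℂ × ℂ × ℂ) (conifoldTransition (perturbedConormal k ε)) q) :
      ∃ (Z : C4) (a T : ℝ), mfderiv 𝓘(ℝ, ℂ × ℂ × ℂ) 𝓘(ℝ, C4) proj₂ q X = Z ∧
        rePart Z = a • k.toFun t₀ + (‖imPart q.proj₂‖ * T) • k.tangent t₀ ∧
        inner ℝ (k.toFun t₀) (imPart Z) = -ε * T ∧
        inner ℝ (k.tangent t₀) (imPart Z) = -(T * inner ℝ (k.accel t₀) (imPart q.proj₂)) ∧
        fderiv ℝ ξ (rePart q.proj₂) (rePart Z) = T • k.accel t₀ := by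
    obtain ⟨z, hz0, hzL, hz⟩ := exists_hasDerivAt_of_mem_tangentVectors hX
    have := velocity_contraction_image hε hξ hξk hz (hzL.mono fun s hs => himage hs)
      (t₀ := t₀) (by rwa [hz0]) (by rwa [hz0])
    rw [hz0] at this
    obtain ⟨a, T, h⟩ := this
    exact ⟨_, a, T, rfl, h⟩
  obtain ⟨Z, a, T, x0, x1, x2, x3, x4⟩ := key hX
  obtain ⟨Z', b, S, y0, y1, y2, y3, y4⟩ := key hY
  rw [perturbedForm_apply, x0, y0, pushforward_shear_apply (hξ.differentiable (by simp)),
    x4, y4, x1, y1]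
  simp only [inner_add_left, inner_smul_left, inner_sub_right, inner_smul_right, x2, x3, y2, y3,
    k.inner_accel, k.inner_tangent_accel]
  simp
  ring

end

end Conifold

theorem theorem2 (k : Conifold.Knot) (ε : ℝ) (hε : 0 < ε) (hε1 : ε < 1) :
    ∃ ξ : Conifold.R4 → Conifold.R4,
      ContDiff ℝ ∞ ξ ∧
      (∃ B : ℝ, ∀ x, ‖fderiv ℝ ξ x‖ ≤ B) ∧
      (∀ t : ℝ, ∀ r : ℝ, ε ≤ r → ξ (r • k.toFun t) = deriv k.toFun t) ∧
      Conifold.IsTameLagrangian Conifold.ResolvedConifold.J Conifold.ResolvedConifold.metric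
        (Conifold.perturbedForm ξ ε)
        (Conifold.conifoldTransition (Conifold.perturbedConormal k ε)) ∧
      (Conifold.perturbedForm ξ ε).ExactOn Conifold.ResolvedConifold.zeroSectionᶜ := by
  open Conifold ResolvedConifold in
  obtain ⟨ξ, hξ, hB, hξk, hcurl⟩ := k.exists_vectorField hε
  have hdiff : Differentiable ℝ ξ := hξ.differentiable (by simp)
  refine ⟨ξ, hξ, hB, hξk, ⟨⟨3, ?_, isEmbeddedSubmanifold_conifoldTransition k hε⟩, ?_, ?_⟩,
    perturbedForm_exactOn hξ ε _⟩
  · simp [Module.finrank_prod, Complex.finrank_real_complex]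
  · have hre : Continuous fun q : ResolvedConifold => rePart q.proj₂ :=
      reL.continuous.comp continuous_proj₂
    have hcont : Continuous fun q : ResolvedConifold => curl ξ (rePart q.proj₂) := by
      have h1 : Continuous (fderiv ℝ ξ) := hξ.continuous_fderiv (by simp)
      exact (h1.sub (ContinuousLinearMap.adjoint.continuous.comp h1)).comp hre
    -- On the transition the two quantities are at most 1 and at least ε, so these strict
    -- inequalities leave room for an open neighbourhood.
    let U : Set ResolvedConifold :=
      {q | ε * ‖curl ξ (rePart q.proj₂)‖ < 3 / 2} ∩ {q | ε / 2 < ‖q.proj₂‖}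
    have htame : (perturbedForm ξ ε).UniformlyTameOn J metric U :=
      perturbedForm_uniformlyTameOn hdiff hε (half_pos hε) fun q hq => ⟨hq.1.le, hq.2.le⟩
    refine ⟨U, ?_, ?_, ⟨perturbedForm_smoothOn hξ ε U, fun q _ => perturbedForm_d hξ ε q,
      nondegenerate_of_uniformlyTameOn htame⟩, htame⟩
    · exact (isOpen_lt (by fun_prop) continuous_const).inter
        (isOpen_lt continuous_const continuous_proj₂.norm)
    · intro q hq
      obtain ⟨t, h1, h2, h3⟩ := (mem_conifoldTransition_iff hε).1 hq
      have hr := le_norm_of_inner_tangent h3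
      have hr0 : 0 < ‖imPart q.proj₂‖ := hε.trans_le hr
      constructor
      · have h4 := hcurl t _ hr
        rw [← h1] at h4
        have h5 : ε * ‖imPart q.proj₂‖⁻¹ ≤ 1 := by
          rw [← div_eq_mul_inv]
          exact (div_le_one hr0).2 hr
        have h6 := mul_le_mul_of_nonneg_left h4 hε.le
        change ε * ‖curl ξ (rePart q.proj₂)‖ < 3 / 2
        linarith
      · have h4 := norm_sq_eq_rePart_imPart q.proj₂
        have h5 : ‖imPart q.proj₂‖ ≤ ‖q.proj₂‖ := by
          refine le_of_sq_le_sq ?_ (norm_nonneg _)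
          nlinarith [sq_nonneg ‖rePart q.proj₂‖]
        change ε / 2 < ‖q.proj₂‖
        linarith
  · intro q hq X hX Y hY
    exact perturbedForm_eq_zero_of_mem_tangentVectors hε hξ hξk hq hX hY
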